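/- Let $\Lambda$ be a path-connected compact metric space, $d\ge 0$, and let $\mathbb{A}=\{\mathbb{A}_n\colon\Lambda\to\mathcal{L}(\mathbb{R}^d)\}_{n\in\mathbb{Z}}$ be an equicontinuous and pointwise bounded family of maps. Let $\ell_0(\mathbb{R}^d)$ be the Banach space of all sequences $\phi\colon\mathbb{Z}\to\mathbb{R}^d$ with $\phi(n)\to0$ as $n\to\pm\infty$, with the supremum norm, and let $L_{\mathbb{A}}\colon\Lambda\to\mathcal{L}(\ell_0(\mathbb{R}^d))$ be given by $$(L_{\mathbb{A}}(\lambda)\phi)(n)=\phi(n+1)-\mathbb{A}_n(\lambda)\phi(n).$$ A real $d\times d$ matrix is called hyperbolic if it has no complex eigenvalue of modulus one (it need not be invertible); $H(d,\mathbb{R})$ denotes the set of these matrices. For $\mathcal{A}\in H(d,\mathbb{R})$ let $P^s_{\mathcal{A}}\in\mathcal{L}(\mathbb{R}^d)$ be the restriction to $\mathbb{R}^d$ of the spectral projection $\frac1{2\pi i}\oint_{|z|=1}(zI-\mathcal{A})^{-1}\,dz$ with respect to the eigenvalues inside the unit circle. Suppose that $\mathbb{A}$ is asymptotically hyperbolic,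 i.e. there are families $\mathcal{A}_\pm\colon\Lambda\to H(d,\mathbb{R})$ such that $\mathbb{A}_n(\lambda)\to\mathcal{A}_\pm(\lambda)$ as $n\to\pm\infty$, uniformly in $\lambda\in\Lambda$. Then $L_{\mathbb{A}}$ is a norm continuous family of Fredholm operators, $P^s_{\mathcal{A}_\pm}\colon\Lambda\to\mathcal{L}(\mathbb{R}^d)$ are continuous families of projections, so that $\mathrm{Im}\,P^s_{\mathcal{A}_\pm}=\{(\lambda,x)\in\Lambda\times\mathbb{R}^d : x\in\mathrm{im}\,P^s_{\mathcal{A}_\pm(\lambda)}\}$ are vector bundles over $\Lambda$, and the index bundle of $L_{\mathbb{A}}$ is $$\mathrm{ind}(L_{\mathbb{A}})=[\mathrm{Im}\,P^s_{\mathcal{A}_+}]-[\mathrm{Im}\,P^s_{\mathcal{A}_-}]\in KO(\Lambda).$$ Here $KO(\Lambda)$ is the Grothendieck group of the semigroup of stable isomorphism classes of real vector bundles of finite rank over $\Lambda$, and $\mathrm{ind}(L)=[E(L,V)]-[\Lambda\times V]$, where $V\subset\ell_0(\mathbb{R}^d)$ is a finite-dimensional subspace with $\mathrm{im}\,L(\lambda)+V=\ell_0(\mathbb{R}^d)$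 for all $\lambda\in\Lambda$ (such a $V$ exists by compactness) and $E(L,V)=\{(\lambda,\phi)\in\Lambda\times\ell_0(\mathbb{R}^d) : L(\lambda)\phi\in V\}$; the formula holds for every such $V$. -/

import Mathlib

open Bundle Topology

namespace FamilyIndex

noncomputable section

/-! ### Real vector bundles and the group `KO` -/

/-- A real vector bundle of finite rank over `B`, in the sense of Mathlib's `VectorBundle`, bundled
together with its model fibre `F`, its fibres `E b` and the topology of its total space. The rank is
constant, which over a connected base is no restriction. -/
structure RealBundle (B : Type*) [TopologicalSpace B] where
  F : Type
  E : B → Type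
  [normedGroupF : NormedAddCommGroup F]
  [normedSpaceF : NormedSpace ℝ F]
  [finiteDimF : FiniteDimensional ℝ F]
  [groupE : ∀ b, AddCommGroup (E b)]
  [moduleE : ∀ b, Module ℝ (E b)]
  [topE : ∀ b, TopologicalSpace (E b)]
  [topTotal : TopologicalSpace (TotalSpace F E)]
  [fiberBundle : FiberBundle F E]
  [vectorBundle : VectorBundle ℝ F E]

attribute [instance] RealBundle.normedGroupF RealBundle.normedSpaceF RealBundle.finiteDimF
  RealBundle.groupE RealBundle.moduleE RealBundle.topE RealBundle.topTotal
  RealBundle.fiberBundle RealBundle.vectorBundle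

namespace RealBundle

variable {B : Type*} [TopologicalSpace B]

/-- Two bundles over `B` are isomorphic if there is a family of linear isomorphisms of the fibres
which, together with its inverse, is continuous on total spaces. -/
def Iso (ξ η : RealBundle B) : Prop :=
  ∃ e : ∀ b, ξ.E b ≃ₗ[ℝ] η.E b,
    Continuous (fun p : TotalSpace ξ.F ξ.E => (⟨p.1, e p.1 p.2⟩ : TotalSpace η.F η.E)) ∧
    Continuous (fun p : TotalSpace η.F η.E => (⟨p.1, (e p.1).symm p.2⟩ : TotalSpace ξ.F ξ.E))

/-- The Whitney sum. -/
def sum (ξ η : RealBundle B) : RealBundle B where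
  F := ξ.F × η.F
  E := ξ.E ×ᵇ η.E

variable (B) in
/-- The product bundle with fibre `V`. -/
def trivial (V : Type) [NormedAddCommGroup V] [NormedSpace ℝ V] [FiniteDimensional ℝ V] :
    RealBundle B where
  F := V
  E := Bundle.Trivial B V

theorem Iso.refl (ξ : RealBundle B) : Iso ξ ξ :=
  ⟨fun b => LinearEquiv.refl ℝ (ξ.E b), continuous_id, continuous_id⟩

theorem Iso.symm {ξ η : RealBundle B} : Iso ξ η → Iso η ξ := by
  rintro ⟨e, h, h'⟩
  exact ⟨fun b => (e b).symm, h', h⟩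

theorem Iso.trans {ξ η ζ : RealBundle B} : Iso ξ η → Iso η ζ → Iso ξ ζ := by
  rintro ⟨e, h, h'⟩ ⟨f, k, k'⟩
  exact ⟨fun b => (e b).trans (f b), k.comp h, h'.comp k'⟩

theorem continuous_sum_iff {X : Type*} [TopologicalSpace X] {ξ η : RealBundle B}
    {f : X → TotalSpace (ξ.sum η).F (ξ.sum η).E} :
    Continuous f ↔
      Continuous (fun x => (⟨(f x).1, (f x).2.1⟩ : TotalSpace ξ.F ξ.E)) ∧
      Continuous (fun x => (⟨(f x).1, (f x).2.2⟩ : TotalSpace η.F η.E)) :=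
  (FiberBundle.Prod.isInducing_diag ξ.F ξ.E η.F η.E).continuous_iff.trans continuous_prodMk

theorem continuous_sum_fst (ξ η : RealBundle B) :
    Continuous (fun p : TotalSpace (ξ.sum η).F (ξ.sum η).E =>
      (⟨p.1, p.2.1⟩ : TotalSpace ξ.F ξ.E)) :=
  (continuous_sum_iff.1 continuous_id).1

theorem continuous_sum_snd (ξ η : RealBundle B) :
    Continuous (fun p : TotalSpace (ξ.sum η).F (ξ.sum η).E =>
      (⟨p.1, p.2.2⟩ : TotalSpace η.F η.E)) :=
  (continuous_sum_iff.1 continuous_id).2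

theorem Iso.sum_congr {ξ ξ' η η' : RealBundle B} :
    Iso ξ ξ' → Iso η η' → Iso (ξ.sum η) (ξ'.sum η') := by
  rintro ⟨e, h, h'⟩ ⟨f, k, k'⟩
  exact ⟨fun b => (e b).prodCongr (f b),
    continuous_sum_iff.2 ⟨h.comp (continuous_sum_fst ξ η), k.comp (continuous_sum_snd ξ η)⟩,
    continuous_sum_iff.2 ⟨h'.comp (continuous_sum_fst ξ' η'), k'.comp (continuous_sum_snd ξ' η')⟩⟩

theorem iso_sum_comm (ξ η : RealBundle B) : Iso (ξ.sum η) (η.sum ξ) :=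
  ⟨fun b => LinearEquiv.prodComm ℝ (ξ.E b) (η.E b),
    continuous_sum_iff.2 ⟨continuous_sum_snd ξ η, continuous_sum_fst ξ η⟩,
    continuous_sum_iff.2 ⟨continuous_sum_snd η ξ, continuous_sum_fst η ξ⟩⟩

theorem iso_sum_assoc (ξ η ζ : RealBundle B) :
    Iso ((ξ.sum η).sum ζ) (ξ.sum (η.sum ζ)) :=
  ⟨fun b => LinearEquiv.prodAssoc ℝ (ξ.E b) (η.E b) (ζ.E b),
    continuous_sum_iff.2 ⟨(continuous_sum_fst ξ η).comp (continuous_sum_fst _ ζ),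
      continuous_sum_iff.2 ⟨(continuous_sum_snd ξ η).comp (continuous_sum_fst _ ζ),
        continuous_sum_snd _ ζ⟩⟩,
    continuous_sum_iff.2 ⟨continuous_sum_iff.2 ⟨continuous_sum_fst ξ _,
        (continuous_sum_fst η ζ).comp (continuous_sum_snd ξ _)⟩,
      (continuous_sum_snd η ζ).comp (continuous_sum_snd ξ _)⟩⟩

theorem continuous_trivial_iff {X : Type*} [TopologicalSpace X] {V : Type} [NormedAddCommGroup V]
    [NormedSpace ℝ V] [FiniteDimensional ℝ V]
    {f : X → TotalSpace (trivial B V).F (trivial B V).E} :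
    Continuous f ↔ Continuous (fun x => (f x).1) ∧ Continuous (fun x => ((f x).2 : V)) :=
  (Bundle.Trivial.homeomorphProd B V).comp_continuous_iff.symm.trans continuous_prodMk

theorem continuous_proj (ξ : RealBundle B) :
    Continuous (fun p : TotalSpace ξ.F ξ.E => p.1) :=
  FiberBundle.continuous_proj ξ.F ξ.E

theorem iso_trivial_sum_of_subsingleton (V : Type) [NormedAddCommGroup V] [NormedSpace ℝ V]
    [FiniteDimensional ℝ V] [Subsingleton V] (ξ : RealBundle B) :
    Iso ((trivial B V).sum ξ) ξ := by
  refine ⟨fun b => LinearEquiv.ofLinearMap (LinearMap.snd ℝ V (ξ.E b)) (LinearMap.inr ℝ V (ξ.E b))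
      ?_ ?_, continuous_sum_snd _ ξ,
      continuous_sum_iff.2 ⟨continuous_trivial_iff.2 ⟨ξ.continuous_proj, continuous_const⟩,
        continuous_id⟩⟩
  · rfl
  · exact LinearMap.ext fun x => Prod.ext (Subsingleton.elim (α := V) _ _) rfl

theorem iso_trivial {V W : Type} [NormedAddCommGroup V] [NormedSpace ℝ V]
    [FiniteDimensional ℝ V] [NormedAddCommGroup W] [NormedSpace ℝ W] [FiniteDimensional ℝ W]
    (e : V ≃L[ℝ] W) : Iso (trivial B V) (trivial B W) :=
  ⟨fun _ => e.toLinearEquiv,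
    continuous_trivial_iff.2 ⟨continuous_proj _,
      e.continuous.comp (continuous_trivial_iff.1 continuous_id).2⟩,
    continuous_trivial_iff.2 ⟨continuous_proj _,
      e.symm.continuous.comp (continuous_trivial_iff.1 continuous_id).2⟩⟩

theorem iso_trivial_sum_trivial (V W : Type) [NormedAddCommGroup V] [NormedSpace ℝ V]
    [FiniteDimensional ℝ V] [NormedAddCommGroup W] [NormedSpace ℝ W] [FiniteDimensional ℝ W] :
    Iso ((trivial B V).sum (trivial B W)) (trivial B (V × W)) :=
  ⟨fun _ => LinearEquiv.refl ℝ (V × W),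
    continuous_trivial_iff.2 ⟨continuous_proj _, Continuous.prodMk
      ((continuous_trivial_iff.1 continuous_id).2.comp (continuous_sum_fst _ _))
      ((continuous_trivial_iff.1 continuous_id).2.comp (continuous_sum_snd _ _))⟩,
    continuous_sum_iff.2
      ⟨continuous_trivial_iff.2 ⟨continuous_proj _,
        continuous_fst.comp (continuous_trivial_iff.1 continuous_id).2⟩,
      continuous_trivial_iff.2 ⟨continuous_proj _,
        continuous_snd.comp (continuous_trivial_iff.1 continuous_id).2⟩⟩⟩

instance isoSetoid (B : Type*) [TopologicalSpace B] : Setoid (RealBundle B) where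
  r := Iso
  iseqv := ⟨Iso.refl, Iso.symm, Iso.trans⟩

end RealBundle

/-- Isomorphism classes of real vector bundles over `B`. -/
def IsoClass (B : Type*) [TopologicalSpace B] := Quotient (RealBundle.isoSetoid B)

instance (B : Type*) [TopologicalSpace B] : Zero (IsoClass B) where
  zero := Quotient.mk _ (RealBundle.trivial B (Fin 0 → ℝ))

instance (B : Type*) [TopologicalSpace B] : Add (IsoClass B) where
  add := Quotient.map₂ RealBundle.sum fun _ _ h _ _ k => RealBundle.Iso.sum_congr h k

/-- The commutative monoid of isomorphism classes under the Whitney sum. -/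
instance (B : Type*) [TopologicalSpace B] : AddCommMonoid (IsoClass B) where
  add_assoc := by
    rintro ⟨ξ⟩ ⟨η⟩ ⟨ζ⟩
    exact Quotient.sound (RealBundle.iso_sum_assoc ξ η ζ)
  zero_add := by
    rintro ⟨ξ⟩
    exact Quotient.sound (RealBundle.iso_trivial_sum_of_subsingleton _ ξ)
  add_zero := by
    rintro ⟨ξ⟩
    exact Quotient.sound ((RealBundle.iso_sum_comm _ _).trans
      (RealBundle.iso_trivial_sum_of_subsingleton _ ξ))
  nsmul := nsmulRec
  add_comm := by
    rintro ⟨ξ⟩ ⟨η⟩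
    exact Quotient.sound (RealBundle.iso_sum_comm ξ η)

/-- The isomorphism class of a bundle. -/
def RealBundle.isoClass {B : Type*} [TopologicalSpace B] (ξ : RealBundle B) : IsoClass B :=
  Quotient.mk _ ξ

/-- The isomorphism class of the product bundle with fibre `ℝⁿ`. -/
def trivialClass (B : Type*) [TopologicalSpace B] (n : ℕ) : IsoClass B :=
  (RealBundle.trivial B (EuclideanSpace ℝ (Fin n))).isoClass

theorem trivialClass_add (B : Type*) [TopologicalSpace B] (m n : ℕ) :
    trivialClass B m + trivialClass B n = trivialClass B (m + n) :=
  Quotient.sound ((RealBundle.iso_trivial_sum_trivial _ _).trans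
    (RealBundle.iso_trivial (ContinuousLinearEquiv.ofFinrankEq (by simp))))

/-- Stable isomorphism: `ξ ⊕ Θ(ℝⁿ) ≅ η ⊕ Θ(ℝⁿ)` for some `n`; a congruence for the Whitney sum. -/
def stableCon (B : Type*) [TopologicalSpace B] : AddCon (IsoClass B) where
  r x y := ∃ n : ℕ, x + trivialClass B n = y + trivialClass B n
  iseqv := by
    refine ⟨fun x => ⟨0, rfl⟩, fun ⟨n, h⟩ => ⟨n, h.symm⟩, ?_⟩
    rintro x y z ⟨m, h⟩ ⟨n, k⟩
    refine ⟨m + n, ?_⟩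
    rw [← trivialClass_add, ← add_assoc, h, add_right_comm, k, add_right_comm, add_assoc]
  add' := by
    rintro w x y z ⟨m, h⟩ ⟨n, k⟩
    refine ⟨m + n, ?_⟩
    rw [← trivialClass_add, add_add_add_comm, h, k, add_add_add_comm]

/-- The group `KO(B)`: the Grothendieck group of the semigroup of stable isomorphism classes of
real vector bundles over `B`. -/
abbrev KO (B : Type*) [TopologicalSpace B] : Type _ :=
  Algebra.GrothendieckAddGroup (stableCon B).Quotient

/-- The class `[ξ]` in `KO(B)` of a vector bundle `ξ`. -/
def RealBundle.toKO {B : Type*} [TopologicalSpace B] (ξ : RealBundle B) : KO B :=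
  Algebra.GrothendieckAddGroup.of ((stableCon B).mk' ξ.isoClass)

/-! ### Families of subspaces of a fixed Banach space as vector bundles -/

section Subfamily

set_option linter.unusedSectionVars false

variable {B : Type*} [TopologicalSpace B]
  {X : Type} [NormedAddCommGroup X] [NormedSpace ℝ X] [CompleteSpace X]

/-- A criterion for a family `W` of finite-dimensional subspaces of `X` to be locally trivial: near
each `b₀` a continuous family `T` of invertible operators, equal to `1` at `b₀`, maps `W b` onto
`W b₀`. -/
def IsLocallyTrivial (W : B → Submodule ℝ X) : Prop :=
  (∀ b, FiniteDimensional ℝ (W b)) ∧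
  ∀ b₀, ∃ T : B → X →L[ℝ] X, Continuous T ∧ T b₀ = 1 ∧
    ∀ b, IsUnit (T b) → ∀ x, x ∈ W b ↔ T b x ∈ W b₀

namespace IsLocallyTrivial

variable {W : B → Submodule ℝ X}

/-- The straightening operators around `b₀`. -/
def T (h : IsLocallyTrivial W) (b₀ : B) : B → X →L[ℝ] X := (h.2 b₀).choose

theorem continuous_T (h : IsLocallyTrivial W) (b₀ : B) : Continuous (h.T b₀) :=
  (h.2 b₀).choose_spec.1

theorem T_self (h : IsLocallyTrivial W) (b₀ : B) : h.T b₀ b₀ = 1 :=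
  (h.2 b₀).choose_spec.2.1

theorem mem_iff (h : IsLocallyTrivial W) (b₀ : B) {b : B} (hb : IsUnit (h.T b₀ b)) (x : X) :
    x ∈ W b ↔ h.T b₀ b x ∈ W b₀ :=
  (h.2 b₀).choose_spec.2.2 b hb x

/-- The open set over which the family is straightened by `T b₀`. -/
def base (h : IsLocallyTrivial W) (b₀ : B) : Set B := {b | IsUnit (h.T b₀ b)}

theorem isOpen_base (h : IsLocallyTrivial W) (b₀ : B) : IsOpen (h.base b₀) :=
  Units.isOpen.preimage (h.continuous_T b₀)

theorem mem_base (h : IsLocallyTrivial W) (b₀ : B) : b₀ ∈ h.base b₀ := by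
  simp [base, T_self]

theorem inv_T_apply (h : IsLocallyTrivial W) {b₀ b : B} (hb : b ∈ h.base b₀) (x : X) :
    Ring.inverse (h.T b₀ b) (h.T b₀ b x) = x :=
  DFunLike.congr_fun (Ring.inverse_mul_cancel _ hb) x

theorem T_inv_apply (h : IsLocallyTrivial W) {b₀ b : B} (hb : b ∈ h.base b₀) (x : X) :
    h.T b₀ b (Ring.inverse (h.T b₀ b) x) = x :=
  DFunLike.congr_fun (Ring.mul_inverse_cancel _ hb) x

theorem continuousOn_inv_T (h : IsLocallyTrivial W) (b₀ : B) :
    ContinuousOn (fun b => Ring.inverse (h.T b₀ b)) (h.base b₀) := by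
  rintro b ⟨u, hu⟩
  have : ContinuousAt Ring.inverse (h.T b₀ b) := hu ▸ NormedRing.inverse_continuousAt u
  exact (this.comp (h.continuous_T b₀).continuousAt).continuousWithinAt

theorem inv_T_mem (h : IsLocallyTrivial W) {b₀ b : B} (hb : b ∈ h.base b₀) {x : X}
    (hx : x ∈ W b₀) : Ring.inverse (h.T b₀ b) x ∈ W b := by
  rw [h.mem_iff b₀ hb, h.T_inv_apply hb]
  exact hx

theorem finrank_eq_of_mem_base (h : IsLocallyTrivial W) {b₀ b : B} (hb : b ∈ h.base b₀) :
    Module.finrank ℝ (W b) = Module.finrank ℝ (W b₀) := by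
  refine LinearEquiv.finrank_eq (LinearEquiv.ofLinearMap
    (((h.T b₀ b).toLinearMap.comp (W b).subtype).codRestrict (W b₀)
      fun x => (h.mem_iff b₀ hb x).1 x.2)
    (((Ring.inverse (h.T b₀ b)).toLinearMap.comp (W b₀).subtype).codRestrict (W b)
      fun x => h.inv_T_mem hb x.2) ?_ ?_)
  · ext x
    exact h.T_inv_apply hb _
  · ext x
    exact h.inv_T_apply hb _

variable [ConnectedSpace B]

theorem finrank_eq (h : IsLocallyTrivial W) (a b : B) :
    Module.finrank ℝ (W a) = Module.finrank ℝ (W b) := by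
  have : IsLocallyConstant fun b => Module.finrank ℝ (W b) := by
    rw [IsLocallyConstant.iff_exists_open]
    exact fun b => ⟨h.base b, h.isOpen_base b, h.mem_base b,
      fun c hc => h.finrank_eq_of_mem_base hc⟩
  exact this.apply_eq_of_isPreconnected isPreconnected_univ trivial trivial

/-- The model fibre. -/
abbrev Fib (_ : IsLocallyTrivial W) : Type :=
  EuclideanSpace ℝ (Fin (Module.finrank ℝ (W (Classical.arbitrary B))))

/-- An identification of one fibre with the model fibre. -/
def chart (h : IsLocallyTrivial W) (b₀ : B) : W b₀ ≃L[ℝ] h.Fib :=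
  haveI := h.1 b₀
  ContinuousLinearEquiv.ofFinrankEq (by
    rw [finrank_euclideanSpace_fin]; exact h.finrank_eq _ _)

theorem exists_proj (h : IsLocallyTrivial W) (b₀ : B) :
    ∃ Q : X →L[ℝ] W b₀, ∀ x : W b₀, Q x = x :=
  haveI := h.1 b₀
  Submodule.ClosedComplemented.of_finiteDimensional (W b₀)

/-- An extension of `chart` to all of `X`. -/
def chartExt (h : IsLocallyTrivial W) (b₀ : B) : X →L[ℝ] h.Fib :=
  (h.chart b₀ : W b₀ →L[ℝ] h.Fib) ∘L (h.exists_proj b₀).choose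

theorem chartExt_apply (h : IsLocallyTrivial W) (b₀ : B) (x : X) (hx : x ∈ W b₀) :
    h.chartExt b₀ x = h.chart b₀ ⟨x, hx⟩ := by
  have := (h.exists_proj b₀).choose_spec ⟨x, hx⟩
  simp only [chartExt, ContinuousLinearMap.comp_apply]
  rw [this]
  rfl

/-- The total space `{(b, x) | x ∈ W b}` carries the subspace topology of `B × X`. -/
instance topTotal (h : IsLocallyTrivial W) :
    TopologicalSpace (TotalSpace h.Fib fun b => W b) :=
  TopologicalSpace.induced (fun p => (p.1, (p.2 : X))) inferInstance

theorem isInducing_total (h : IsLocallyTrivial W) :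
    IsInducing (fun p : TotalSpace h.Fib (fun b => W b) => (p.1, (p.2 : X))) := ⟨rfl⟩

open Classical in
/-- The local trivialization around `b₀` given by `T b₀`. -/
def localTriv (h : IsLocallyTrivial W) (b₀ : B) :
    Trivialization h.Fib (π h.Fib (fun b => W b)) where
  toFun p := (p.1, h.chartExt b₀ (h.T b₀ p.1 p.2))
  invFun q := ⟨q.1, if hb : q.1 ∈ h.base b₀ then
    ⟨Ring.inverse (h.T b₀ q.1) ((h.chart b₀).symm q.2), h.inv_T_mem hb (Subtype.coe_prop _)⟩ else 0⟩
  source := π h.Fib (fun b => W b) ⁻¹' h.base b₀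
  target := h.base b₀ ×ˢ Set.univ
  map_source' p hp := ⟨hp, trivial⟩
  map_target' q hq := hq.1
  left_inv' := by
    rintro ⟨b, x⟩ (hb : b ∈ h.base b₀)
    have hx := (h.mem_iff b₀ hb x).1 x.2
    simp only [hb, dif_pos, h.chartExt_apply b₀ _ hx, ContinuousLinearEquiv.symm_apply_apply,
      h.inv_T_apply hb]
  right_inv' := by
    rintro ⟨b, f⟩ ⟨hb : b ∈ h.base b₀, -⟩
    simp only [hb, dif_pos, h.T_inv_apply hb]
    rw [h.chartExt_apply b₀ _ (Subtype.coe_prop _)]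
    simp
  open_source := (h.isOpen_base b₀).preimage
    (continuous_fst.comp h.isInducing_total.continuous)
  open_target := (h.isOpen_base b₀).prod isOpen_univ
  continuousOn_toFun := by
    have h1 := h.isInducing_total.continuous
    have h2 := h.continuous_T b₀
    refine Continuous.continuousOn ((continuous_fst.comp h1).prodMk
      ((h.chartExt b₀).continuous.comp ?_))
    exact (h2.comp (continuous_fst.comp h1)).clm_apply (continuous_snd.comp h1)
  continuousOn_invFun := by
    rw [h.isInducing_total.continuousOn_iff]
    refine continuousOn_fst.prodMk ?_
    have : ContinuousOn (fun q : B × h.Fib =>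
        Ring.inverse (h.T b₀ q.1) ((h.chart b₀).symm q.2 : X)) (h.base b₀ ×ˢ Set.univ) := by
      refine ContinuousOn.clm_apply ((h.continuousOn_inv_T b₀).comp continuousOn_fst
        fun q hq => hq.1) (Continuous.continuousOn ?_)
      exact continuous_subtype_val.comp ((h.chart b₀).symm.continuous.comp continuous_snd)
    refine this.congr ?_
    rintro ⟨b, f⟩ ⟨hb : b ∈ h.base b₀, -⟩
    simp only [hb, dif_pos]
  baseSet := h.base b₀
  open_baseSet := h.isOpen_base b₀
  source_eq := rfl
  target_eq := rfl
  proj_toFun _ _ := rfl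

theorem localTriv_apply (h : IsLocallyTrivial W) (b₀ : B)
    (p : TotalSpace h.Fib (fun b => W b)) :
    h.localTriv b₀ p = (p.1, h.chartExt b₀ (h.T b₀ p.1 p.2)) := rfl

theorem localTriv_invFun (h : IsLocallyTrivial W) {b₀ b : B} (hb : b ∈ h.base b₀) (f : h.Fib) :
    (h.localTriv b₀).invFun (b, f) =
      ⟨b, ⟨Ring.inverse (h.T b₀ b) ((h.chart b₀).symm f), h.inv_T_mem hb (Subtype.coe_prop _)⟩⟩ :=
  congrArg (TotalSpace.mk b) (dif_pos hb)

instance fiberBundle (h : IsLocallyTrivial W) : FiberBundle h.Fib (fun b => W b) where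
  totalSpaceMk_isInducing' b := by
    refine IsInducing.of_comp_iff h.isInducing_total |>.1 ?_
    exact (Topology.IsEmbedding.of_comp (f := fun x : W b => (b, (x : X))) (g := Prod.snd)
      (by fun_prop) continuous_snd Topology.IsEmbedding.subtypeVal).isInducing
  trivializationAtlas' := Set.range h.localTriv
  trivializationAt' := h.localTriv
  mem_baseSet_trivializationAt' := h.mem_base
  trivialization_mem_atlas' b := ⟨b, rfl⟩

instance isLinear_localTriv (h : IsLocallyTrivial W) (b₀ : B) : (h.localTriv b₀).IsLinear ℝ where
  linear b _ :=
    { map_add := fun x y => by simp [localTriv_apply]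
      map_smul := fun c x => by simp [localTriv_apply] }

instance vectorBundle (h : IsLocallyTrivial W) : VectorBundle ℝ h.Fib (fun b => W b) where
  trivialization_linear' := by
    rintro _ ⟨b₀, rfl⟩
    infer_instance
  continuousOn_coordChange' := by
    rintro _ _ ⟨b₀, rfl⟩ ⟨b₁, rfl⟩
    have key : ContinuousOn (fun b => h.chartExt b₁ ∘L h.T b₁ b ∘L Ring.inverse (h.T b₀ b) ∘L
        ((W b₀).subtypeL ∘L ((h.chart b₀).symm : h.Fib →L[ℝ] W b₀)))
        (h.base b₀ ∩ h.base b₁) := by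
      refine continuousOn_const.clm_comp ((h.continuous_T b₁).continuousOn.clm_comp
        (ContinuousOn.clm_comp ?_ continuousOn_const))
      exact (h.continuousOn_inv_T b₀).mono Set.inter_subset_left
    refine key.congr ?_
    rintro b hb
    ext1 f
    rw [ContinuousLinearEquiv.coe_coe, Trivialization.coordChangeL_apply' _ _ hb]
    have hb0 : b ∈ h.base b₀ := hb.1
    change (h.localTriv b₁ ((h.localTriv b₀).invFun (b, f))).2 = _
    rw [h.localTriv_invFun hb0, localTriv_apply]
    rfl

/-- The vector bundle `{(b, x) | x ∈ W b} ⊆ B × X`, with the subspace topology. -/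
def bundle (h : IsLocallyTrivial W) : RealBundle B :=
  letI := h.topTotal
  letI := h.fiberBundle
  letI := h.vectorBundle
  { F := h.Fib
    E := fun b => W b }

end IsLocallyTrivial

/-- A continuous family of projections of `X` of finite rank. -/
structure IsProjectionFamily (P : B → X →L[ℝ] X) : Prop where
  continuous : Continuous P
  idem : ∀ b, P b ∘L P b = P b
  finite : ∀ b, FiniteDimensional ℝ (P b).range

theorem IsProjectionFamily.isLocallyTrivial {P : B → X →L[ℝ] X} (hP : IsProjectionFamily P) :
    IsLocallyTrivial fun b => (P b).range := by
  refine ⟨hP.finite, fun b₀ => ⟨fun b => P b₀ * P b + (1 - P b₀) * (1 - P b), ?_, ?_, ?_⟩⟩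
  · have := hP.continuous
    fun_prop
  · have : P b₀ * P b₀ = P b₀ := hP.idem b₀
    simp [mul_sub, sub_mul, this]
  · have hmem : ∀ b x, x ∈ (P b).range ↔ P b x = x := by
      intro b x
      constructor
      · rintro ⟨y, rfl⟩
        exact DFunLike.congr_fun (hP.idem b) y
      · exact fun h => ⟨x, h⟩
    intro b hu x
    have h0 : P b₀ * P b₀ = P b₀ := hP.idem b₀
    have h1 : P b * P b = P b := hP.idem b
    set S := P b₀ * P b + (1 - P b₀) * (1 - P b) with hS
    have e : S * P b = P b₀ * S := by
      simp only [hS, add_mul, mul_add, mul_sub, sub_mul, mul_assoc, h1, one_mul, mul_one]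
      simp only [← mul_assoc, h0]
      abel
    have e' : S (P b x) = P b₀ (S x) := DFunLike.congr_fun e x
    rw [hmem, hmem, ← e']
    have inj : Function.Injective S := by
      intro y z hyz
      have k := fun y => DFunLike.congr_fun (Ring.inverse_mul_cancel S hu) y
      have k1 : Ring.inverse S (S y) = y := k y
      have k2 : Ring.inverse S (S z) = z := k z
      rw [← k1, hyz, k2]
    exact inj.eq_iff.symm

/-- The bundle `IM P = {(b, x) | x ∈ im (P b)}` of images of a continuous family of
projections. -/
def imageBundle [ConnectedSpace B] {P : B → X →L[ℝ] X} (hP : IsProjectionFamily P) :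
    RealBundle B :=
  hP.isLocallyTrivial.bundle

end Subfamily

/-! ### The index bundle of a family of Fredholm operators -/

section Fredholm

variable {B : Type*} [TopologicalSpace B]
  {X Y : Type} [NormedAddCommGroup X] [NormedSpace ℝ X] [CompleteSpace X]
  [NormedAddCommGroup Y] [NormedSpace ℝ Y] [CompleteSpace Y]

/-- A continuous family of Fredholm operators. -/
structure IsFredholmFamily (L : B → X →L[ℝ] Y) : Prop where
  continuous : Continuous L
  isFredholm : ∀ b, (L b).IsFredholm

/-- `V` is a finite-dimensional subspace with `im (L b) + V = Y` for all `b`. -/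
structure IsTransversal (L : B → X →L[ℝ] Y) (V : Submodule ℝ Y) : Prop where
  finite : FiniteDimensional ℝ V
  sup_eq_top : ∀ b, (L b).range ⊔ V = ⊤

/-- If `G₀` is surjective with finite-dimensional kernel, any family `G` through `G₀` is
straightened near `G₀`. -/
theorem exists_straightening {Z : Type} [NormedAddCommGroup Z] [NormedSpace ℝ Z] [CompleteSpace Z]
    {G : B → X →L[ℝ] Z} (hG : Continuous G) (b₀ : B) (hker : FiniteDimensional ℝ (G b₀).ker)
    (hsurj : Function.Surjective (G b₀)) :
    ∃ T : B → X →L[ℝ] X, Continuous T ∧ T b₀ = 1 ∧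
      ∀ b, (∀ x, G b x = 0 ↔ G b₀ (T b x) = 0) ∧
        (IsUnit (T b) → Function.Surjective (G b)) := by
  obtain ⟨Q, hQ⟩ := Submodule.ClosedComplemented.of_finiteDimensional (G b₀).ker
  have hbij : ((Q.prod (G b₀)) : X →L[ℝ] (G b₀).ker × Z).ker = ⊥ ∧
      ((Q.prod (G b₀)) : X →L[ℝ] (G b₀).ker × Z).range = ⊤ := by
    constructor
    · rw [LinearMap.ker_eq_bot']
      intro x hx
      have h1 : Q x = 0 := congrArg Prod.fst hx
      have h2 : G b₀ x = 0 := congrArg Prod.snd hx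
      have := hQ ⟨x, h2⟩
      rw [h1] at this
      exact congrArg Subtype.val this.symm
    · rw [LinearMap.range_eq_top]
      rintro ⟨k, z⟩
      obtain ⟨x, rfl⟩ := hsurj z
      have hk : G b₀ (k : X) = 0 := k.2
      have hq : G b₀ (Q x : X) = 0 := (Q x).2
      refine ⟨x - Q x + k, Prod.ext ?_ ?_⟩
      · simp [hQ]
      · simp [hk, hq]
  let S : X ≃L[ℝ] (G b₀).ker × Z := ContinuousLinearEquiv.ofBijective _ hbij.1 hbij.2
  have hS : ∀ x, S x = (Q x, G b₀ x) := fun x => rfl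
  have hT : ∀ b x, G b₀ (S.symm (Q x, G b x)) = G b x := fun b x => by
    have := congrArg Prod.snd (hS (S.symm (Q x, G b x)))
    rw [S.apply_symm_apply] at this
    exact this.symm
  refine ⟨fun b => (S.symm : (G b₀).ker × Z →L[ℝ] X) ∘L Q.prod (G b), ?_, ?_, ?_⟩
  · refine continuous_const.clm_comp ?_
    have : (fun b => Q.prod (G b)) = fun b =>
        ContinuousLinearMap.inl ℝ (G b₀).ker Z ∘L Q + ContinuousLinearMap.inr ℝ _ _ ∘L G b := by
      ext b x <;> simp
    rw [this]
    exact continuous_const.add (continuous_const.clm_comp hG)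
  · ext x
    exact S.symm_apply_apply x
  · refine fun b => ⟨fun x => ?_, fun hu z => ?_⟩
    · exact (hT b x).symm ▸ Iff.rfl
    · obtain ⟨x, hx⟩ := hsurj z
      refine ⟨Ring.inverse ((S.symm : (G b₀).ker × Z →L[ℝ] X) ∘L Q.prod (G b)) x, ?_⟩
      rw [← hT b, ← hx]
      exact congrArg (G b₀) (DFunLike.congr_fun (Ring.mul_inverse_cancel _ hu) x)

/-- The fibres `(L b)⁻¹(V)` form a locally trivial family. -/
theorem IsTransversal.isLocallyTrivial {L : B → X →L[ℝ] Y} (hL : IsFredholmFamily L)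
    {V : Submodule ℝ Y} (hV : IsTransversal L V) :
    IsLocallyTrivial fun b => V.comap (L b : X →ₗ[ℝ] Y) := by
  have := hV.finite
  have : IsClosed (V : Set Y) := V.closed_of_finiteDimensional
  have hfin : ∀ b, FiniteDimensional ℝ (V.comap (L b : X →ₗ[ℝ] Y)) := fun b => by
    have : FiniteDimensional ℝ (LinearMap.ker (L b : X →ₗ[ℝ] Y)) := (hL.isFredholm b).finite_ker
    infer_instance
  refine ⟨hfin, fun b₀ => ?_⟩
  have hmem : ∀ b x, x ∈ V.comap (L b : X →ₗ[ℝ] Y) ↔ (V.mkQL ∘L L b) x = 0 := fun b x =>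
    (Submodule.Quotient.mk_eq_zero V).symm
  obtain ⟨T, hT, h1, h2⟩ := exists_straightening (G := fun b => V.mkQL ∘L L b)
    (continuous_const.clm_comp hL.continuous) b₀ (by
      have : (V.mkQL ∘L L b₀).ker = V.comap (L b₀ : X →ₗ[ℝ] Y) := by
        ext x
        exact (hmem b₀ x).symm
      rw [this]
      exact hfin b₀) (by
      intro z
      obtain ⟨y, rfl⟩ := Submodule.Quotient.mk_surjective V z
      have : y ∈ (L b₀).range ⊔ V := hV.sup_eq_top b₀ ▸ Submodule.mem_top
      obtain ⟨_, ⟨x, rfl⟩, v, hv, rfl⟩ := Submodule.mem_sup.1 this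
      refine ⟨x, ?_⟩
      refine (Submodule.Quotient.eq V).2 ?_
      simpa using hv)
  refine ⟨T, hT, h1, fun b _ x => ?_⟩
  rw [hmem, hmem]
  exact (h2 b).1 x

/-- The vector bundle `E(L, V) = {(b, x) | L b x ∈ V}`, a subspace of `B × X`. -/
def kernelBundle [ConnectedSpace B] {L : B → X →L[ℝ] Y} (hL : IsFredholmFamily L)
    {V : Submodule ℝ Y} (hV : IsTransversal L V) : RealBundle B :=
  (hV.isLocallyTrivial hL).bundle

/-- The class `[E(L, V)] - [Θ(V)]` in `KO(B)`. -/
def indexClass [ConnectedSpace B] {L : B → X →L[ℝ] Y} (hL : IsFredholmFamily L)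
    {V : Submodule ℝ Y} (hV : IsTransversal L V) : KO B :=
  haveI := hV.finite
  (kernelBundle hL hV).toKO - (RealBundle.trivial B V).toKO

theorem IsFredholmFamily.exists_isTransversal [CompactSpace B] {L : B → X →L[ℝ] Y}
    (hL : IsFredholmFamily L) : ∃ V : Submodule ℝ Y, IsTransversal L V := by
  have hloc : ∀ b₀, ∃ V : Submodule ℝ Y, FiniteDimensional ℝ V ∧
      ∃ U : Set B, IsOpen U ∧ b₀ ∈ U ∧ ∀ b ∈ U, (L b).range ⊔ V = ⊤ := by
    intro b₀
    obtain ⟨V, hc⟩ := (L b₀).range.exists_isCompl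
    have hVf : FiniteDimensional ℝ V := by
      have := (hL.isFredholm b₀).finite_coker
      exact .of_fg (Submodule.CoFG.fg_of_isCompl hc inferInstance)
    have : IsClosed (V : Set Y) := V.closed_of_finiteDimensional
    have hmk : ∀ b, Function.Surjective (V.mkQL ∘L L b) → (L b).range ⊔ V = ⊤ := by
      intro b hb
      rw [eq_top_iff]
      intro y _
      obtain ⟨x, hx⟩ := hb (V.mkQL y)
      have hxy : y - L b x ∈ V := (Submodule.Quotient.eq V).1 hx.symm
      exact Submodule.mem_sup.2 ⟨L b x, ⟨x, rfl⟩, _, hxy, by simp⟩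
    obtain ⟨T, hT, h1, h2⟩ := exists_straightening (G := fun b => V.mkQL ∘L L b)
      (continuous_const.clm_comp hL.continuous) b₀ (by
        have : (V.mkQL ∘L L b₀).ker = (L b₀).ker := by
          ext x
          constructor
          · intro hx
            have hx' : L b₀ x ∈ V := (Submodule.Quotient.mk_eq_zero V).1 hx
            exact Submodule.disjoint_def.1 hc.disjoint _ ⟨x, rfl⟩ hx'
          · intro hx
            have hx' : L b₀ x = 0 := hx
            change V.mkQL (L b₀ x) = 0
            rw [hx', map_zero]
        rw [this]
        exact (hL.isFredholm b₀).finite_ker) (by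
        intro z
        obtain ⟨y, rfl⟩ := Submodule.Quotient.mk_surjective V z
        have : y ∈ (L b₀).range ⊔ V := hc.sup_eq_top ▸ Submodule.mem_top
        obtain ⟨_, ⟨x, rfl⟩, v, hv, rfl⟩ := Submodule.mem_sup.1 this
        refine ⟨x, ?_⟩
        refine (Submodule.Quotient.eq V).2 ?_
        simpa using hv)
    refine ⟨V, hVf, {b | IsUnit (T b)}, Units.isOpen.preimage hT, ?_,
      fun b hb => hmk b ((h2 b).2 hb)⟩
    simp [h1]
  choose V hVf U hU hmem hUV using hloc
  obtain ⟨t, ht⟩ := isCompact_univ.elim_finite_subcover U hU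
    fun b _ => Set.mem_iUnion.2 ⟨b, hmem b⟩
  refine ⟨t.sup V, ⟨?_, fun b => ?_⟩⟩
  · have := hVf
    exact Submodule.finiteDimensional_finset_sup t V
  · obtain ⟨b₀, hb₀, hb⟩ := Set.mem_iUnion₂.1 (ht (Set.mem_univ b))
    rw [eq_top_iff, ← hUV b₀ b hb]
    exact sup_le_sup_left (Finset.le_sup hb₀) _

/-- The index bundle `ind L = [E(L, V)] - [Θ(V)]` of a family of Fredholm operators over a compact
connected space, for some finite-dimensional `V` transversal to all the images (the class does not
depend on `V`). -/
def indexBundle [CompactSpace B] [ConnectedSpace B] {L : B → X →L[ℝ] Y}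
    (hL : IsFredholmFamily L) : KO B :=
  indexClass hL hL.exists_isTransversal.choose_spec

end Fredholm

/-! ### Linear discrete vector fields -/

section Dynamics

open scoped ZeroAtInfty
open Filter

/-- Bounded linear operators of `ℝᵈ`. -/
abbrev Op (d : ℕ) : Type := EuclideanSpace ℝ (Fin d) →L[ℝ] EuclideanSpace ℝ (Fin d)

/-- The Banach space `ℓ₀(ℝᵈ)` of two-sided sequences in `ℝᵈ` that tend to `0` at `±∞`, with the
supremum norm (`ℤ` is discrete). -/
abbrev SeqZero (d : ℕ) : Type := C₀(ℤ, EuclideanSpace ℝ (Fin d))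

/-- A parametrized linear discrete vector field: a family of maps `A n : Λ → L(ℝᵈ)`, `n ∈ ℤ`, which
is equicontinuous and pointwise bounded. -/
structure LinearField (Λ : Type*) [TopologicalSpace Λ] (d : ℕ) where
  A : ℤ → Λ → Op d
  equicontinuous : Equicontinuous A
  bounded : ∀ b, ∃ C : ℝ, ∀ n, ‖A n b‖ ≤ C

/-- The left shift `(S φ)(n) = φ(n + 1)` of `ℓ₀(ℝᵈ)`. -/
def shift (d : ℕ) : SeqZero d →L[ℝ] SeqZero d :=
  LinearMap.mkContinuous
    { toFun := fun φ =>
        { toFun := fun n => φ (n + 1)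
          continuous_toFun := continuous_of_discreteTopology
          zero_at_infty' := (zero_at_infty φ).comp
            (Homeomorph.addRight (1 : ℤ)).isClosedEmbedding.tendsto_cocompact }
      map_add' := fun _ _ => rfl
      map_smul' := fun _ _ => rfl } 1 (by
    intro φ
    rw [one_mul, ← ZeroAtInftyContinuousMap.norm_toBCF_eq_norm]
    exact (BoundedContinuousFunction.norm_le (norm_nonneg _)).2 fun n =>
      φ.toBCF.norm_coe_le_norm (n + 1))

theorem norm_apply_le {d : ℕ} (φ : SeqZero d) (n : ℤ) : ‖φ n‖ ≤ ‖φ‖ :=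
  φ.toBCF.norm_coe_le_norm n

/-- The multiplication operator `(N φ)(n) = a(n) φ(n)` of `ℓ₀(ℝᵈ)` for a bounded sequence of
operators `a`. -/
def nemitski {d : ℕ} (a : ℤ → Op d) (ha : ∃ C : ℝ, ∀ n, ‖a n‖ ≤ C) : SeqZero d →L[ℝ] SeqZero d :=
  LinearMap.mkContinuousOfExistsBound
    { toFun := fun φ =>
        { toFun := fun n => a n (φ n)
          continuous_toFun := continuous_of_discreteTopology
          zero_at_infty' := by
            obtain ⟨C, hC⟩ := ha
            refine squeeze_zero_norm (fun n => (a n).le_of_opNorm_le (hC n) (φ n)) ?_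
            simpa using (zero_at_infty φ).norm.const_mul C }
      map_add' := fun φ ψ => ZeroAtInftyContinuousMap.ext fun n => (a n).map_add (φ n) (ψ n)
      map_smul' := fun c φ => ZeroAtInftyContinuousMap.ext fun n => (a n).map_smul c (φ n) } (by
    obtain ⟨C, hC⟩ := ha
    have hC0 : 0 ≤ C := (norm_nonneg _).trans (hC 0)
    refine ⟨C, fun φ => ?_⟩
    rw [← ZeroAtInftyContinuousMap.norm_toBCF_eq_norm]
    exact (BoundedContinuousFunction.norm_le (by positivity)).2 fun n =>
      ((a n).le_of_opNorm_le (hC n) (φ n)).trans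
        (mul_le_mul_of_nonneg_left (norm_apply_le φ n) hC0))

/-- The family of operators `L_A(b) = S - N_{A(b)}` of `ℓ₀(ℝᵈ)`, that is
`(L_A(b) φ)(n) = φ(n + 1) - A n b (φ n)`. -/
def LinearField.L {Λ : Type*} [TopologicalSpace Λ] {d : ℕ} (𝔸 : LinearField Λ d) (b : Λ) :
    SeqZero d →L[ℝ] SeqZero d :=
  shift d - nemitski (fun n => 𝔸.A n b) (𝔸.bounded b)

theorem LinearField.L_apply {Λ : Type*} [TopologicalSpace Λ] {d : ℕ} (𝔸 : LinearField Λ d) (b : Λ)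
    (φ : SeqZero d) (n : ℤ) : 𝔸.L b φ n = φ (n + 1) - 𝔸.A n b (φ n) := rfl

/-- The complexification on `ℂᵈ` of an operator of `ℝᵈ`: the operator with the same matrix. -/
def complexify {d : ℕ} (a : Op d) : EuclideanSpace ℂ (Fin d) →L[ℂ] EuclideanSpace ℂ (Fin d) :=
  Matrix.toEuclideanCLM (𝕜 := ℂ)
    (((Matrix.toEuclideanCLM (𝕜 := ℝ) (n := Fin d)).symm a).map Complex.ofReal)

/-- An operator of `ℝᵈ` is hyperbolic if it has no complex eigenvalue of modulus one. -/
def IsHyperbolic {d : ℕ} (a : Op d) : Prop :=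
  ∀ z ∈ spectrum ℂ (complexify a), ‖z‖ ≠ 1

/-- The spectral projection `(2πi)⁻¹ ∮_{|z| = 1} (z - a)⁻¹ dz` of `ℂᵈ` with respect to the
eigenvalues inside the unit circle. -/
def spectralProjection {d : ℕ} (a : Op d) :
    EuclideanSpace ℂ (Fin d) →L[ℂ] EuclideanSpace ℂ (Fin d) :=
  (2 * Real.pi * Complex.I)⁻¹ • circleIntegral (fun z => resolvent (complexify a) z) 0 1

/-- The projection `Pˢ_a` of `ℝᵈ` onto the stable space of a hyperbolic `a`: the restriction to
`ℝᵈ` of `spectralProjection a`, whose matrix has real entries. -/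
def stableProjection {d : ℕ} (a : Op d) : Op d :=
  Matrix.toEuclideanCLM (𝕜 := ℝ)
    (((Matrix.toEuclideanCLM (𝕜 := ℂ) (n := Fin d)).symm (spectralProjection a)).map Complex.re)

/-- `𝔸` is asymptotically hyperbolic with limits `a₊`, `a₋`: these are families of hyperbolic
operators, and `A n` tends to `a₊` for `n → ∞` and to `a₋` for `n → -∞`, uniformly on `Λ`. -/
structure IsAsymptoticallyHyperbolic {Λ : Type*} [TopologicalSpace Λ] {d : ℕ}
    (𝔸 : LinearField Λ d) (aPos aNeg : Λ → Op d) : Prop where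
  hyperbolic_pos : ∀ b, IsHyperbolic (aPos b)
  hyperbolic_neg : ∀ b, IsHyperbolic (aNeg b)
  tendsto_pos : TendstoUniformly 𝔸.A aPos atTop
  tendsto_neg : TendstoUniformly 𝔸.A aNeg atBot

end Dynamics

end

end FamilyIndex

open FamilyIndex

/-! Write `S` for the shift. For hyperbolic `a` the operator `S - a` of `ℓ₀(ℝᵈ)` is invertible. Over
`ℂ` it is a difference of two commuting operators; the characteristic polynomial of `a` annihilates
one of them and is invertible at the other, because the spectrum of the shift lies on the unit
circle (`isUnit_constOp`). Its inverse `green a` ties the contour integral to the dynamics: the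
Laurent coefficients of the resolvent, applied to `x`, form the decaying solution `ψ` of `(S - a) ψ
= single x`, so that `Pˢ_a x` is the value of `green a (single x)` at `0`
(`stableProjection_apply`). Hence `Pˢ_a` depends continuously on `a`, fixes `φ 0` for a decaying
forward solution `φ`, and kills `a (φ (-1))` for a decaying backward one.

The formula is proved for a model operator `M` that equals `S - a₊` at indices `n ≥ 0` and `S - a₋`
at `n < 0`. With `V₁` the sequences supported at `-1`, the condition `M φ ∈ V₁` decouples the two
halves of `φ`, and `φ ↦ (φ 0, a₋ (φ (-1)))` identifies `E(M, V₁)` with `im Pˢ₊ ⊕ ker Pˢ₋`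
(`toKO_kernelBundle_modelOp`). Since `V₁ ≅ ℝᵈ = ker Pˢ₋ ⊕ im Pˢ₋`, the difference `[E(M, V₁)] -
[Θ(V₁)]` is the asserted one (`indexClass_modelOp`).

Off a finite set `s` of indices, `L` is uniformly close to `M`. A small correction of the identity
gives invertible operators `T b` such that `L - M T` takes values in the sequences supported in `s`
(`exists_units`). So `L` is Fredholm, and `T` carries `E(L, V)` onto `E(M, V)` for that space `V`.
Changing `V` is harmless, because `E(L, W) ⊕ V ≅ E(L, V) ⊕ W` when `V ≤ W` (`indexClass_eq_of_le`).
-/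

namespace FamilyIndex

noncomputable section

/-! ### Isomorphisms and sums of bundles of subspaces, and their classes in `KO`. -/

section Bundles

variable {B : Type*} [TopologicalSpace B]

theorem RealBundle.toKO_eq_of_iso {ξ η : RealBundle B} (h : ξ.Iso η) : ξ.toKO = η.toKO :=
  congrArg (fun x => Algebra.GrothendieckAddGroup.of ((stableCon B).mk' x)) (Quotient.sound h)

theorem RealBundle.toKO_sum (ξ η : RealBundle B) : (ξ.sum η).toKO = ξ.toKO + η.toKO := by
  have : (ξ.sum η).isoClass = ξ.isoClass + η.isoClass := rfl
  simp only [RealBundle.toKO, this, map_add]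

/-- The total space carries the topology induced from `B × X`, so continuity into it is tested there
and no local trivialization is needed. -/
theorem IsLocallyTrivial.continuous_bundle_iff [ConnectedSpace B] {X : Type}
    [NormedAddCommGroup X] [NormedSpace ℝ X] [CompleteSpace X] {W : B → Submodule ℝ X}
    (h : IsLocallyTrivial W) {Z : Type*} [TopologicalSpace Z]
    {f : Z → TotalSpace h.bundle.F h.bundle.E} :
    Continuous f ↔ Continuous (fun z => (f z).1) ∧
      Continuous (fun z => ((show W (f z).1 from (f z).2 : W (f z).1) : X)) :=
  h.isInducing_total.continuous_iff.trans continuous_prodMk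

theorem IsLocallyTrivial.continuous_coe [ConnectedSpace B] {X : Type}
    [NormedAddCommGroup X] [NormedSpace ℝ X] [CompleteSpace X] {W : B → Submodule ℝ X}
    (h : IsLocallyTrivial W) :
    Continuous (fun p : TotalSpace h.bundle.F h.bundle.E => ((show W p.1 from p.2 : W p.1) : X)) :=
  (h.continuous_bundle_iff.1 continuous_id).2

/-- Two families of subspaces exchanged by two continuous families of operators which are inverse
to each other on them are isomorphic. -/
theorem IsLocallyTrivial.bundle_iso [ConnectedSpace B] {X Y : Type}
    [NormedAddCommGroup X] [NormedSpace ℝ X] [CompleteSpace X]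
    [NormedAddCommGroup Y] [NormedSpace ℝ Y] [CompleteSpace Y]
    {W : B → Submodule ℝ X} {W' : B → Submodule ℝ Y}
    (h : IsLocallyTrivial W) (h' : IsLocallyTrivial W')
    (F : B → X →L[ℝ] Y) (hF : Continuous F) (G : B → Y →L[ℝ] X) (hG : Continuous G)
    (hFW : ∀ b, ∀ x ∈ W b, F b x ∈ W' b) (hGW : ∀ b, ∀ y ∈ W' b, G b y ∈ W b)
    (hGF : ∀ b, ∀ x ∈ W b, G b (F b x) = x) (hFG : ∀ b, ∀ y ∈ W' b, F b (G b y) = y) :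
    h.bundle.Iso h'.bundle := by
  have h1 : ∀ b (y : W' b), F b (G b y) = y := fun b y => hFG b y y.2
  have h2 : ∀ b (x : W b), G b (F b x) = x := fun b x => hGF b x x.2
  refine ⟨fun b => LinearEquiv.ofLinearMap
    (((F b : X →ₗ[ℝ] Y).comp (W b).subtype).codRestrict (W' b) fun x => hFW b x x.2)
    (((G b : Y →ₗ[ℝ] X).comp (W' b).subtype).codRestrict (W b) fun x => hGW b x x.2)
    (LinearMap.ext fun y => Subtype.ext (h1 b y)) (LinearMap.ext fun x => Subtype.ext (h2 b x)),
    h'.continuous_bundle_iff.2 ⟨h.bundle.continuous_proj, ?_⟩,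
    h.continuous_bundle_iff.2 ⟨h'.bundle.continuous_proj, ?_⟩⟩
  · exact (hF.comp h.bundle.continuous_proj).clm_apply h.continuous_coe
  · exact (hG.comp h'.bundle.continuous_proj).clm_apply h'.continuous_coe

theorem isLocallyTrivial_const {X : Type} [NormedAddCommGroup X] [NormedSpace ℝ X]
    (V : Submodule ℝ X) [FiniteDimensional ℝ V] : IsLocallyTrivial fun _ : B => V :=
  ⟨fun _ => inferInstance, fun _ => ⟨fun _ => 1, continuous_const, rfl, fun _ _ _ => Iff.rfl⟩⟩

theorem bundle_const_iso [ConnectedSpace B] {X : Type} [NormedAddCommGroup X] [NormedSpace ℝ X]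
    [CompleteSpace X] (V : Submodule ℝ X) [FiniteDimensional ℝ V] :
    (isLocallyTrivial_const (B := B) V).bundle.Iso (.trivial B V) := by
  have h := isLocallyTrivial_const (B := B) V
  exact ⟨fun _ => LinearEquiv.refl ℝ V,
    RealBundle.continuous_trivial_iff.2 ⟨RealBundle.continuous_proj _,
      continuous_induced_rng.2 h.continuous_coe⟩,
    h.continuous_bundle_iff.2 ⟨RealBundle.continuous_proj _,
      continuous_subtype_val.comp (RealBundle.continuous_trivial_iff.1 continuous_id).2⟩⟩

section Prod

variable {X Y : Type} [NormedAddCommGroup X] [NormedSpace ℝ X] [CompleteSpace X]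
  [NormedAddCommGroup Y] [NormedSpace ℝ Y] [CompleteSpace Y]
  {W : B → Submodule ℝ X} {W' : B → Submodule ℝ Y}

omit [CompleteSpace X] [CompleteSpace Y] in
-- The diagonal blocks of the inverse are the inverses of the factors. This lets a straightening of
-- a product be split: the criterion `IsLocallyTrivial` only speaks about points where the
-- straightening operator is a unit.
theorem isUnit_of_isUnit_prodMap {S : X →L[ℝ] X} {T : Y →L[ℝ] Y} (h : IsUnit (S.prodMap T)) :
    IsUnit S ∧ IsUnit T := by
  obtain ⟨u, hu⟩ := h
  have h1 : ∀ p : X × Y, S.prodMap T (u⁻¹.1 p) = p := fun p => by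
    rw [← hu]
    exact DFunLike.congr_fun u.mul_inv p
  have h2 : ∀ p : X × Y, u⁻¹.1 (S.prodMap T p) = p := fun p => by
    rw [← hu]
    exact DFunLike.congr_fun u.inv_mul p
  constructor
  · refine ⟨⟨S, ContinuousLinearMap.fst ℝ X Y ∘L u⁻¹.1 ∘L ContinuousLinearMap.inl ℝ X Y,
      ContinuousLinearMap.ext fun x => congrArg Prod.fst (h1 (x, 0)),
      ContinuousLinearMap.ext fun x => ?_⟩, rfl⟩
    have := congrArg Prod.fst (h2 (x, 0))
    simpa using this
  · refine ⟨⟨T, ContinuousLinearMap.snd ℝ X Y ∘L u⁻¹.1 ∘L ContinuousLinearMap.inr ℝ X Y,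
      ContinuousLinearMap.ext fun x => congrArg Prod.snd (h1 (0, x)),
      ContinuousLinearMap.ext fun x => ?_⟩, rfl⟩
    have := congrArg Prod.snd (h2 (0, x))
    simpa using this

omit [CompleteSpace X] [CompleteSpace Y] in
/-- The product of two subspaces as a submodule of the product is their product as a module. -/
def prodLinearEquiv (V : Submodule ℝ X) (V' : Submodule ℝ Y) : V.prod V' ≃ₗ[ℝ] V × V' where
  toFun p := (⟨p.1.1, p.2.1⟩, ⟨p.1.2, p.2.2⟩)
  map_add' _ _ := rfl
  map_smul' _ _ := rfl
  invFun p := ⟨(p.1, p.2), p.1.2, p.2.2⟩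
  left_inv _ := rfl
  right_inv _ := rfl

omit [CompleteSpace X] [CompleteSpace Y] in
theorem IsLocallyTrivial.prod (h : IsLocallyTrivial W) (h' : IsLocallyTrivial W') :
    IsLocallyTrivial fun b => (W b).prod (W' b) := by
  refine ⟨fun b => ?_, fun b₀ => ?_⟩
  · have := h.1 b
    have := h'.1 b
    exact (prodLinearEquiv (W b) (W' b)).symm.finiteDimensional
  · obtain ⟨S, hS, hS0, hSW⟩ := h.2 b₀
    obtain ⟨T, hT, hT0, hTW⟩ := h'.2 b₀
    refine ⟨fun b => (S b).prodMap (T b), ?_, ?_, fun b hb p => ?_⟩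
    · exact hS.prod_mapL ℝ hT
    · change (S b₀).prodMap (T b₀) = 1
      rw [hS0, hT0]
      rfl
    · obtain ⟨h1, h2⟩ := isUnit_of_isUnit_prodMap hb
      exact and_congr (hSW b h1 p.1) (hTW b h2 p.2)

theorem IsLocallyTrivial.bundle_prod_iso [ConnectedSpace B] (h : IsLocallyTrivial W)
    (h' : IsLocallyTrivial W') : (h.prod h').bundle.Iso (h.bundle.sum h'.bundle) := by
  refine ⟨fun b => prodLinearEquiv (W b) (W' b), RealBundle.continuous_sum_iff.2
    ⟨h.continuous_bundle_iff.2 ⟨RealBundle.continuous_proj _, ?_⟩,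
      h'.continuous_bundle_iff.2 ⟨RealBundle.continuous_proj _, ?_⟩⟩,
    (h.prod h').continuous_bundle_iff.2 ⟨RealBundle.continuous_proj _, Continuous.prodMk ?_ ?_⟩⟩
  · exact continuous_fst.comp (h.prod h').continuous_coe
  · exact continuous_snd.comp (h.prod h').continuous_coe
  · exact h.continuous_coe.comp (RealBundle.continuous_sum_fst _ _)
  · exact h'.continuous_coe.comp (RealBundle.continuous_sum_snd _ _)

theorem IsLocallyTrivial.toKO_prod [ConnectedSpace B] (h : IsLocallyTrivial W)
    (h' : IsLocallyTrivial W') :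
    (h.prod h').bundle.toKO = h.bundle.toKO + h'.bundle.toKO := by
  rw [RealBundle.toKO_eq_of_iso (h.bundle_prod_iso h'), RealBundle.toKO_sum]

end Prod

end Bundles

/-! ### Norm continuity of families of operators. -/

theorem continuous_clm_prod {B X Y Z : Type*} [TopologicalSpace B]
    [NormedAddCommGroup X] [NormedSpace ℝ X] [NormedAddCommGroup Y] [NormedSpace ℝ Y]
    [NormedAddCommGroup Z] [NormedSpace ℝ Z] {F : B → X →L[ℝ] Y} {G : B → X →L[ℝ] Z}
    (hF : Continuous F) (hG : Continuous G) : Continuous fun b => (F b).prod (G b) := by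
  have : (fun b => (F b).prod (G b)) = fun b =>
      ContinuousLinearMap.inl ℝ Y Z ∘L F b + ContinuousLinearMap.inr ℝ Y Z ∘L G b := by
    ext b x <;> simp
  rw [this]
  exact (continuous_const.clm_comp hF).add (continuous_const.clm_comp hG)

theorem continuous_ringInverse {B X : Type*} [TopologicalSpace B] [NormedAddCommGroup X]
    [NormedSpace ℝ X] [CompleteSpace X] {F : B → X →L[ℝ] X} (hF : Continuous F)
    (h : ∀ b, IsUnit (F b)) : Continuous fun b => Ring.inverse (F b) := by
  rw [continuous_iff_continuousAt]
  intro b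
  obtain ⟨u, hu⟩ := h b
  have : ContinuousAt Ring.inverse (F b) := hu ▸ NormedRing.inverse_continuousAt u
  exact this.comp hF.continuousAt

theorem continuous_comp_comp {B X Y Z W : Type*} [TopologicalSpace B]
    [NormedAddCommGroup X] [NormedSpace ℝ X] [NormedAddCommGroup Y] [NormedSpace ℝ Y]
    [NormedAddCommGroup Z] [NormedSpace ℝ Z] [NormedAddCommGroup W] [NormedSpace ℝ W]
    {F : B → X →L[ℝ] Y} (hF : Continuous F) (S : Y →L[ℝ] Z) (T : W →L[ℝ] X) :
    Continuous fun b => S ∘L F b ∘L T :=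
  continuous_const.clm_comp (hF.clm_comp continuous_const)

theorem continuous_of_norm_sub_le {B X Y : Type*} [SeminormedAddCommGroup B]
    [NormedAddCommGroup X] [NormedSpace ℝ X] [NormedAddCommGroup Y] [NormedSpace ℝ Y]
    {F : B → X →L[ℝ] Y} (h : ∀ a b, ‖F a - F b‖ ≤ ‖a - b‖) : Continuous F := by
  refine (LipschitzWith.of_dist_le_mul (K := 1) fun a b => ?_).continuous
  rw [dist_eq_norm, dist_eq_norm, NNReal.coe_one, one_mul]
  exact h a b

/-! ### Right inverses modulo a subspace, and independence of the index class of the transversal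
subspace. -/

section Index

variable {B : Type*} [TopologicalSpace B] {X Y : Type}
  [NormedAddCommGroup X] [NormedSpace ℝ X] [CompleteSpace X]
  [NormedAddCommGroup Y] [NormedSpace ℝ Y] [CompleteSpace Y]

omit [CompleteSpace X] [CompleteSpace Y] in
-- `R` is an inverse up to finite rank on both sides: `L R - 1` has range in `V`, and `R L - 1` has
-- range in `L⁻¹(V)`, because `L (R L x - x) = (L R - 1) (L x)`.
theorem isFredholm_of_rightInverse_mod {L : X →L[ℝ] Y} (R : Y →L[ℝ] X) (V : Submodule ℝ Y)
    [FiniteDimensional ℝ V] (hE : FiniteDimensional ℝ (V.comap (L : X →ₗ[ℝ] Y)))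
    (hR : ∀ y, L (R y) - y ∈ V) : L.IsFredholm := by
  refine ContinuousLinearMap.IsFredholm.of_isQuasiInverse (v := R) ⟨?_, ?_⟩
  · refine LinearMap.FiniteRangeSetoid.equiv_iff_hasFiniteRange.2 (Submodule.FG.of_le
      ((Submodule.fg_iff_finiteDimensional _).2 hE) ?_)
    rintro _ ⟨x, rfl⟩
    have : L (R (L x) - x) ∈ V := by
      rw [map_sub]
      exact hR (L x)
    exact this
  · refine LinearMap.FiniteRangeSetoid.equiv_iff_hasFiniteRange.2 (Submodule.FG.of_le
      ((Submodule.fg_iff_finiteDimensional V).2 inferInstance) ?_)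
    rintro _ ⟨y, rfl⟩
    exact hR y

theorem exists_rightInverse_of_surjective {G : X →L[ℝ] Y} (hG : G.range = ⊤)
    (hker : G.ker.ClosedComplemented) : ∃ r : Y →L[ℝ] X, ∀ y, G (r y) = y := by
  obtain ⟨Q, hQ⟩ := hker
  let e := G.equivProdOfSurjectiveOfIsCompl Q hG (LinearMap.range_eq_of_proj hQ)
    (LinearMap.isCompl_of_proj hQ)
  refine ⟨(e.symm : Y × G.ker →L[ℝ] X) ∘L ContinuousLinearMap.inl ℝ Y G.ker, fun y => ?_⟩
  exact congrArg Prod.fst (e.apply_symm_apply (y, 0))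

/-- If `r` is a right inverse of `G b₀`, then `G b ∘ r` is the identity at `b₀`, hence invertible
nearby, and `r ∘ (G b ∘ r)⁻¹` is a right inverse of `G b`. -/
theorem exists_local_rightInverse {G : B → X →L[ℝ] Y} (hG : Continuous G) (b₀ : B)
    (hsurj : (G b₀).range = ⊤) (hker : (G b₀).ker.ClosedComplemented) :
    ∃ U ∈ 𝓝 b₀, ∃ g : B → Y →L[ℝ] X, ContinuousOn g U ∧ ∀ b ∈ U, ∀ y, G b (g b y) = y := by
  obtain ⟨r, hr⟩ := exists_rightInverse_of_surjective hsurj hker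
  let K : B → Y →L[ℝ] Y := fun b => G b ∘L r
  have hK : Continuous K := hG.clm_comp continuous_const
  have hK0 : K b₀ = 1 := ContinuousLinearMap.ext hr
  have hU : {b | IsUnit (K b)} ∈ 𝓝 b₀ := by
    refine (Units.isOpen.preimage hK).mem_nhds ?_
    change IsUnit (K b₀)
    rw [hK0]
    exact isUnit_one
  refine ⟨_, hU, fun b => r ∘L Ring.inverse (K b), ?_, fun b (hb : IsUnit (K b)) y => ?_⟩
  · refine continuousOn_const.clm_comp ?_
    rintro b ⟨u, hu⟩
    have : ContinuousAt Ring.inverse (K b) := hu ▸ NormedRing.inverse_continuousAt u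
    exact (this.comp hK.continuousAt).continuousWithinAt
  · exact DFunLike.congr_fun (Ring.mul_inverse_cancel (K b) hb) y

omit [TopologicalSpace B] [CompleteSpace X] [CompleteSpace Y] in
theorem IsTransversal.mono {L : B → X →L[ℝ] Y} {V W : Submodule ℝ Y} (hV : IsTransversal L V)
    (hVW : V ≤ W) [hW : FiniteDimensional ℝ W] : IsTransversal L W :=
  ⟨hW, fun b => top_le_iff.1 ((hV.sup_eq_top b).symm.le.trans (sup_le_sup_left hVW _))⟩

omit [TopologicalSpace B] [CompleteSpace X] [CompleteSpace Y] in
theorem isTransversal_of_rightInverse_mod {L : B → X →L[ℝ] Y} (R : B → Y →L[ℝ] X)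
    (V : Submodule ℝ Y) [hV : FiniteDimensional ℝ V] (hR : ∀ b y, L b (R b y) - y ∈ V) :
    IsTransversal L V := by
  refine ⟨hV, fun b => top_le_iff.1 fun y _ => ?_⟩
  refine Submodule.mem_sup.2 ⟨L b (R b y), ⟨_, rfl⟩, y - L b (R b y), ?_, by abel⟩
  rw [← neg_sub]
  exact V.neg_mem (hR b y)

/-- A family of operators transversal to `V` has a continuous family of right inverses
modulo `V`. -/
theorem IsTransversal.exists_rightInverse [NormalSpace B] [ParacompactSpace B]
    {L : B → X →L[ℝ] Y} (hL : IsFredholmFamily L) {V : Submodule ℝ Y} (hV : IsTransversal L V) :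
    ∃ R : B → Y →L[ℝ] X, Continuous R ∧ ∀ b y, L b (R b y) - y ∈ V := by
  have := hV.finite
  have hVc : IsClosed (V : Set Y) := V.closed_of_finiteDimensional
  have hlocal : ∀ b₀, ∃ U ∈ 𝓝 b₀, ∃ g : B → Y →L[ℝ] X, ContinuousOn g U ∧
      ∀ b ∈ U, g b ∈ {r : Y →L[ℝ] X | ∀ y, L b (r y) - y ∈ V} := by
    intro b₀
    have hmk : ∀ b x y, L b x - y ∈ V ↔ V.mkQL (L b x) = V.mkQL y := fun b x y =>
      (Submodule.Quotient.eq V).symm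
    have hker : (V.mkQL ∘L L b₀).ker = V.comap (L b₀ : X →ₗ[ℝ] Y) := by
      ext x
      exact Submodule.Quotient.mk_eq_zero V
    have hfin : FiniteDimensional ℝ (V.mkQL ∘L L b₀).ker := by
      rw [hker]
      have : FiniteDimensional ℝ (LinearMap.ker (L b₀ : X →ₗ[ℝ] Y)) := (hL.isFredholm b₀).finite_ker
      infer_instance
    have hsurj : (V.mkQL ∘L L b₀).range = ⊤ := by
      rw [LinearMap.range_eq_top]
      intro z
      obtain ⟨y, rfl⟩ := Submodule.Quotient.mk_surjective V z
      have : y ∈ (L b₀).range ⊔ V := hV.sup_eq_top b₀ ▸ Submodule.mem_top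
      obtain ⟨_, ⟨x, rfl⟩, v, hv, rfl⟩ := Submodule.mem_sup.1 this
      refine ⟨x, (Submodule.Quotient.eq V).2 ?_⟩
      simpa using hv
    have hcompl : (V.mkQL ∘L L b₀).ker.ClosedComplemented :=
      Submodule.ClosedComplemented.of_finiteDimensional _
    obtain ⟨U, hU, g, hg, hGg⟩ := exists_local_rightInverse (G := fun b => V.mkQL ∘L L b)
      (continuous_const.clm_comp hL.continuous) b₀ hsurj hcompl
    exact ⟨U, hU, fun b => g b ∘L V.mkQL, hg.clm_comp continuousOn_const,
      fun b hb y => (hmk b _ y).2 (hGg b hb _)⟩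
  -- Being a right inverse modulo `V` is an affine condition, so the local choices are glued by a
  -- partition of unity.
  have hconvex : ∀ b, Convex ℝ {r : Y →L[ℝ] X | ∀ y, L b (r y) - y ∈ V} := by
    intro b r hr s hs α β hα hβ hαβ y
    have : L b ((α • r + β • s) y) - y = α • (L b (r y) - y) + β • (L b (s y) - y) := by
      have hy : y = α • y + β • y := by rw [← add_smul, hαβ, one_smul]
      rw [smul_sub, smul_sub, sub_add_sub_comm, ← hy]
      simp
    rw [this]
    exact V.add_mem (V.smul_mem _ (hr y)) (V.smul_mem _ (hs y))
  obtain ⟨g, hg⟩ := exists_continuous_forall_mem_convex_of_local hconvex hlocal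
  exact ⟨g, g.continuous, hg⟩

/-- Enlarging the transversal subspace does not change the index class. -/
theorem indexClass_eq_of_le [NormalSpace B] [ParacompactSpace B] [ConnectedSpace B]
    {L : B → X →L[ℝ] Y} (hL : IsFredholmFamily L) {V W : Submodule ℝ Y}
    (hV : IsTransversal L V) (hW : IsTransversal L W) (hVW : V ≤ W) :
    indexClass hL hV = indexClass hL hW := by
  have := hV.finite
  have := hW.finite
  obtain ⟨R, hRc, hR⟩ := hV.exists_rightInverse hL
  obtain ⟨p, hp⟩ := Submodule.ClosedComplemented.of_finiteDimensional V
  -- `q` is a projection with kernel `V`. It preserves `W` because `V ≤ W`, and `R b ∘ q` is used to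
  -- lift the part of `W` transverse to `V`.
  let q : Y →L[ℝ] Y := 1 - V.subtypeL ∘L p
  have hqV : ∀ y ∈ V, q y = 0 := fun y hy => by
    have : (p y : Y) = y := congrArg Subtype.val (hp ⟨y, hy⟩)
    simp [q, this]
  have hq : ∀ y, y - q y ∈ V := fun y => by simp [q]
  have hqW : ∀ y ∈ W, q y ∈ W := fun y hy => by
    simpa [q] using W.sub_mem hy (hVW (p y).2)
  have hqq : ∀ y, q (q y) = q y := fun y => by
    have := hqV _ (hq y)
    rw [map_sub, sub_eq_zero] at this
    exact this.symm
  have hqR : ∀ b y, q (L b (R b (q y))) = q y := fun b y => by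
    have := hqV _ (hR b (q y))
    rwa [map_sub, sub_eq_zero, hqq] at this
  have hWm : ∀ b x, L b x ∈ W → L b (x - R b (q (L b x))) ∈ V := fun b x _ => by
    have := V.sub_mem (hq (L b x)) (hR b (q (L b x)))
    rw [map_sub]
    convert this using 1
    abel
  have hVm : ∀ b x, ∀ w ∈ W, L b x ∈ V → L b (x + R b (q w)) ∈ W := fun b x w hw hx => by
    have := W.add_mem (W.add_mem (hVW hx) (hVW (hR b (q w)))) (hqW w hw)
    rw [map_add]
    convert this using 1
    abel
  have hEV := hV.isLocallyTrivial hL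
  have hEW := hW.isLocallyTrivial hL
  have hcV := isLocallyTrivial_const (B := B) V
  have hcW := isLocallyTrivial_const (B := B) W
  have hL' := hL.continuous
  -- `E(L, W) ⊕ V ≅ E(L, V) ⊕ W` by `(x, v) ↦ (x - R q L x, q L x + v)`, with inverse `(x, w) ↦ (x +
  -- R q w, w - q w)`. The component of `L x` outside `V` is moved from the first summand to the
  -- second.
  have h := RealBundle.toKO_eq_of_iso <| (hEW.prod hcV).bundle_iso (hEV.prod hcW)
    (fun b => ((ContinuousLinearMap.fst ℝ X Y) -
        R b ∘L q ∘L L b ∘L ContinuousLinearMap.fst ℝ X Y).prod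
      (q ∘L L b ∘L ContinuousLinearMap.fst ℝ X Y + ContinuousLinearMap.snd ℝ X Y))
    (continuous_clm_prod (by fun_prop) (by fun_prop))
    (fun b => ((ContinuousLinearMap.fst ℝ X Y) +
        R b ∘L q ∘L ContinuousLinearMap.snd ℝ X Y).prod
      (ContinuousLinearMap.snd ℝ X Y - q ∘L ContinuousLinearMap.snd ℝ X Y))
    (continuous_clm_prod (by fun_prop) (by fun_prop))
    (fun b p hp => ⟨hWm b p.1 hp.1, W.add_mem (hqW _ hp.1) (hVW hp.2)⟩)
    (fun b p hp => ⟨hVm b p.1 p.2 hp.2 hp.1, hq p.2⟩)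
    (by
      rintro b ⟨x, v⟩ ⟨hx : L b x ∈ W, hv : v ∈ V⟩
      have h1 : q (q (L b x) + v) = q (L b x) := by
        rw [map_add, hqq, hqV _ hv, add_zero]
      refine Prod.ext ?_ ?_
      · change x - R b (q (L b x)) + R b (q (q (L b x) + v)) = x
        rw [h1, sub_add_cancel]
      · change q (L b x) + v - q (q (L b x) + v) = v
        rw [h1, add_sub_cancel_left])
    (by
      rintro b ⟨x, w⟩ ⟨hx : L b x ∈ V, hw : w ∈ W⟩
      have h1 : q (L b (x + R b (q w))) = q w := by
        rw [map_add, map_add, hqV _ hx, hqR, zero_add]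
      refine Prod.ext ?_ ?_
      · change x + R b (q w) - R b (q (L b (x + R b (q w)))) = x
        rw [h1, add_sub_cancel_right]
      · change q (L b (x + R b (q w))) + (w - q w) = w
        rw [h1, add_sub_cancel])
  rw [hEW.toKO_prod hcV, hEV.toKO_prod hcW, RealBundle.toKO_eq_of_iso (bundle_const_iso V),
    RealBundle.toKO_eq_of_iso (bundle_const_iso W)] at h
  rw [indexClass, indexClass, sub_eq_sub_iff_add_eq_add]
  exact h.symm

/-- The index class does not depend on the transversal subspace. -/
theorem indexClass_eq [NormalSpace B] [ParacompactSpace B] [ConnectedSpace B]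
    {L : B → X →L[ℝ] Y} (hL : IsFredholmFamily L) {V W : Submodule ℝ Y}
    (hV : IsTransversal L V) (hW : IsTransversal L W) :
    indexClass hL hV = indexClass hL hW := by
  have := hV.finite
  have := hW.finite
  have hVW : IsTransversal L (V ⊔ W) := hV.mono le_sup_left
  rw [indexClass_eq_of_le hL hV hVW le_sup_left, indexClass_eq_of_le hL hW hVW le_sup_right]

end Index

/-! ### Invertibility through the characteristic polynomial, and Laurent coefficients of the
resolvent. -/

section Resolvent

open Filter Polynomial

theorem exists_mul_eq_aeval_sub {A : Type*} [Ring A] [Algebra ℂ A] {x y : A} (h : Commute x y)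
    (p : ℂ[X]) : ∃ q, (x - y) * q = aeval x p - aeval y p := by
  induction p using Polynomial.induction_on' with
  | add p₁ p₂ h₁ h₂ =>
    obtain ⟨q₁, hq₁⟩ := h₁
    obtain ⟨q₂, hq₂⟩ := h₂
    exact ⟨q₁ + q₂, by rw [mul_add, hq₁, hq₂, map_add, map_add]; abel⟩
  | monomial n c =>
    obtain ⟨q, hq⟩ := h.sub_dvd_pow_sub_pow n
    exact ⟨c • q, by rw [mul_smul_comm, ← hq, aeval_monomial, aeval_monomial, smul_sub,
      Algebra.smul_def, Algebra.smul_def]⟩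

theorem exists_eq_aeval_sub_mul {A : Type*} [Ring A] [Algebra ℂ A] {x y : A} (h : Commute x y)
    (p : ℂ[X]) : ∃ q, q * (x - y) = aeval x p - aeval y p := by
  induction p using Polynomial.induction_on' with
  | add p₁ p₂ h₁ h₂ =>
    obtain ⟨q₁, hq₁⟩ := h₁
    obtain ⟨q₂, hq₂⟩ := h₂
    exact ⟨q₁ + q₂, by rw [add_mul, hq₁, hq₂, map_add, map_add]; abel⟩
  | monomial n c =>
    refine ⟨c • ∑ i ∈ Finset.range n, x ^ i * y ^ (n - 1 - i), ?_⟩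
    rw [smul_mul_assoc, h.geom_sum₂_mul, aeval_monomial, aeval_monomial, smul_sub,
      Algebra.smul_def, Algebra.smul_def]

/-- For commuting `x`, `y` the difference `x - y` divides `p(x) - p(y) = p(x)`, which is a unit. A
factorization on each side yields an inverse on each side. -/
theorem isUnit_sub_of_commute {A : Type*} [Ring A] [Algebra ℂ A] {x y : A} (h : Commute x y)
    (p : ℂ[X]) (hy : aeval y p = 0) (hx : IsUnit (aeval x p)) : IsUnit (x - y) := by
  obtain ⟨q, hq⟩ := exists_mul_eq_aeval_sub h p
  obtain ⟨r, hr⟩ := exists_eq_aeval_sub_mul h p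
  rw [hy, sub_zero] at hq hr
  rw [isUnit_iff_exists_and_exists]
  refine ⟨⟨q * Ring.inverse (aeval x p), ?_⟩, ⟨Ring.inverse (aeval x p) * r, ?_⟩⟩
  · rw [← mul_assoc, hq, Ring.mul_inverse_cancel _ hx]
  · rw [mul_assoc, hr, Ring.inverse_mul_cancel _ hx]

variable {A : Type*} [NormedRing A] [NormedAlgebra ℂ A] [CompleteSpace A]

/-- The spectra of `u` and of `u⁻¹` both lie in the closed unit disc, and inversion exchanges them.
The bound on `‖1‖` replaces `‖1‖ = 1`, which fails in the zero algebra that occurs for `d = 0`. -/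
theorem norm_eq_one_of_mem_spectrum_unit (u : Aˣ) (hu : ‖(u : A)‖ ≤ 1) (hu' : ‖(u⁻¹ : Aˣ).1‖ ≤ 1)
    (h1 : ‖(1 : A)‖ ≤ 1) {z : ℂ} (hz : z ∈ spectrum ℂ (u : A)) : ‖z‖ = 1 := by
  have hle : ∀ a : A, ‖a‖ ≤ 1 → ∀ w ∈ spectrum ℂ a, ‖w‖ ≤ 1 := fun a ha w hw =>
    (spectrum.norm_le_norm_mul_of_mem hw).trans (mul_le_one₀ ha (norm_nonneg _) h1)
  have hz0 : z ≠ 0 := spectrum.ne_zero_of_mem_of_unit hz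
  have hinv : z⁻¹ ∈ spectrum ℂ (u⁻¹ : Aˣ).1 :=
    (spectrum.inv_mem_iff (r := Units.mk0 z hz0) (a := u)).1 hz
  have h2 := hle _ hu' _ hinv
  rw [norm_inv] at h2
  exact le_antisymm (hle _ hu _ hz) ((inv_le_one₀ (norm_pos_iff.2 hz0)).1 h2)

/-- By Cayley–Hamilton the characteristic polynomial of `a` annihilates `Φ a`. Its roots are
eigenvalues of `a`, hence off the unit circle, while the spectrum of `u` is on it; by spectral
mapping the polynomial is invertible at `u`. -/
theorem isUnit_unit_sub_algHom {E : Type*} [NormedAddCommGroup E] [NormedSpace ℂ E]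
    [FiniteDimensional ℂ E] (u : Aˣ) (hu : ‖(u : A)‖ ≤ 1)
    (hu' : ‖(u⁻¹ : Aˣ).1‖ ≤ 1) (h1 : ‖(1 : A)‖ ≤ 1) {a : E →L[ℂ] E}
    (ha : ∀ z ∈ spectrum ℂ a, ‖z‖ ≠ 1) (Φ : (E →L[ℂ] E) →ₐ[ℂ] A)
    (hcomm : Commute (u : A) (Φ a)) : IsUnit ((u : A) - Φ a) := by
  let ι : (E →L[ℂ] E) →ₐ[ℂ] Module.End ℂ E := AlgHom.ofLinearMap
    (ContinuousLinearMap.coeLM ℂ) rfl fun _ _ => rfl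
  let p := (ι a).charpoly
  refine isUnit_sub_of_commute hcomm p ?_ ?_
  · have h : aeval a p = 0 := by
      apply ContinuousLinearMap.coe_injective
      exact (aeval_algHom_apply ι a p).symm.trans (LinearMap.aeval_self_charpoly _)
    rw [aeval_algHom_apply, h, map_zero]
  · nontriviality A
    rw [← spectrum.zero_notMem_iff ℂ, spectrum.map_polynomial_aeval_of_nonempty _ _
      (spectrum.nonempty _)]
    rintro ⟨z, hz, hpz⟩
    have h2 : z ∈ spectrum ℂ (ι a) := (Module.End.mem_spectrum_iff_isRoot_charpoly _ _).2 hpz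
    exact ha z (AlgHom.spectrum_apply_subset ι a h2)
      (norm_eq_one_of_mem_spectrum_unit u hu hu' h1 hz)

/-- The Laurent coefficients on the unit circle of the resolvent of `a`. -/
def resolventCoeff (a : A) (n : ℤ) : A :=
  (2 * Real.pi * Complex.I : ℂ)⁻¹ • circleIntegral (fun z => z ^ n • resolvent a z) 0 1

theorem continuousOn_resolvent {a : A} (ha : ∀ z ∈ spectrum ℂ a, ‖z‖ ≠ 1) :
    ContinuousOn (resolvent a) (Metric.sphere (0 : ℂ) 1) := by
  intro z hz
  have : z ∈ resolventSet ℂ a := by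
    by_contra h
    exact ha z h (by simpa using hz)
  exact (spectrum.hasDerivAt_resolvent_const_left this).continuousAt.continuousWithinAt

omit [CompleteSpace A] in
theorem circleIntegrable_zpow_smul {f : ℂ → A} (hf : ContinuousOn f (Metric.sphere (0 : ℂ) 1))
    (n : ℤ) : CircleIntegrable (fun z => z ^ n • f z) 0 1 := by
  refine ContinuousOn.circleIntegrable zero_le_one (ContinuousOn.smul ?_ hf)
  intro z hz
  refine (continuousAt_zpow₀ z n (Or.inl ?_)).continuousWithinAt
  rintro rfl
  simp at hz

/-- Multiplying `(z - a) (z - a)⁻¹ = 1` by `zⁿ` and integrating leaves `∮ zⁿ dz`, which is nonzero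
only for `n = -1`. -/
theorem resolventCoeff_succ_sub {a : A} (ha : ∀ z ∈ spectrum ℂ a, ‖z‖ ≠ 1) (n : ℤ) :
    resolventCoeff a (n + 1) - a * resolventCoeff a n = if n = -1 then 1 else 0 := by
  have hr := continuousOn_resolvent ha
  have h1 : a * circleIntegral (fun z => z ^ n • resolvent a z) 0 1 =
      circleIntegral (fun z => z ^ n • (a * resolvent a z)) 0 1 := by
    have := (ContinuousLinearMap.mul ℂ A a).intervalIntegral_comp_comm
      (circleIntegrable_zpow_smul hr n).out
    simp only [circleIntegral]
    refine Eq.trans this.symm ?_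
    simp
  have h2 : Set.EqOn (fun z : ℂ => z ^ (n + 1) • resolvent a z - z ^ n • (a * resolvent a z))
      (fun z => z ^ n • (1 : A)) (Metric.sphere 0 1) := by
    intro z hz
    have hz0 : z ≠ 0 := by
      rintro rfl
      simp at hz
    have hz1 : IsUnit (algebraMap ℂ A z - a) := by
      by_contra h
      exact ha z h (by simpa using hz)
    have : (algebraMap ℂ A z - a) * resolvent a z = 1 := Ring.mul_inverse_cancel _ hz1
    rw [← this]
    simp only [zpow_add_one₀ hz0, mul_smul, sub_mul, smul_sub, Algebra.algebraMap_eq_smul_one,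
      smul_mul_assoc, one_mul]
  rw [resolventCoeff, resolventCoeff, mul_smul_comm, h1, ← smul_sub, ← circleIntegral.integral_sub
    (circleIntegrable_zpow_smul hr _) (circleIntegrable_zpow_smul
      (f := fun z => a * resolvent a z) (continuousOn_const.mul hr) _),
    circleIntegral.integral_congr zero_le_one h2]
  have h3 : circleIntegral (fun z => z ^ n • (1 : A)) 0 1 =
      (circleIntegral (fun z => z ^ n) 0 1) • (1 : A) := by
    simp [circleIntegral, ← intervalIntegral.integral_smul_const, mul_smul]
  rw [h3]
  split_ifs with hn
  · subst hn
    have := circleIntegral.integral_sub_center_inv (0 : ℂ) (R := 1) one_ne_zero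
    simp only [sub_zero] at this
    rw [show (fun z : ℂ => z ^ (-1 : ℤ)) = fun z => z⁻¹ from funext zpow_neg_one, this, smul_smul,
      inv_mul_cancel₀ Complex.two_pi_I_ne_zero, one_smul]
  · have := circleIntegral.integral_sub_zpow_of_ne hn 0 0 1
    simp only [sub_zero] at this
    rw [this, zero_smul, smul_zero]

omit [CompleteSpace A] in
-- In the angle variable these are Fourier coefficients, so the Riemann–Lebesgue lemma applies. It
-- needs no integrability, since integrals of non-integrable functions are zero by convention.
theorem tendsto_resolventCoeff (a : A) :
    Tendsto (resolventCoeff a) (cocompact ℤ) (𝓝 0) := by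
  let f : ℝ → A := (Set.Ioc 0 (2 * Real.pi)).indicator fun θ =>
    deriv (circleMap 0 1) θ • resolvent a (circleMap 0 1 θ)
  have h1 := Real.tendsto_integral_exp_smul_cocompact f
  -- The Fourier character at frequency `w` is `exp (-2πi θ w)`; it equals `exp (i n θ) = zⁿ` for `w
  -- = -n / (2π)`.
  have h2 : Tendsto (fun n : ℤ => -(n : ℝ) / (2 * Real.pi)) (cocompact ℤ) (cocompact ℝ) := by
    have h3 : Tendsto (fun n : ℤ => (n : ℝ)) (cocompact ℤ) (cocompact ℝ) :=
      Int.isClosedEmbedding_coe_real.tendsto_cocompact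
    have h4 : (-(2 * Real.pi)⁻¹ : ℝ) ≠ 0 := by
      simp [Real.pi_ne_zero]
    refine ((Homeomorph.mulLeft₀ _ h4).isClosedEmbedding.tendsto_cocompact.comp h3).congr fun n => ?_
    simp
    ring
  have h5 := (h1.comp h2).const_smul (2 * Real.pi * Complex.I : ℂ)⁻¹
  rw [smul_zero] at h5
  refine h5.congr fun n => ?_
  simp only [Function.comp_apply, resolventCoeff, circleIntegral]
  congr 1
  rw [intervalIntegral.integral_of_le Real.two_pi_pos.le,
    ← MeasureTheory.integral_indicator measurableSet_Ioc]
  congr 1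
  ext θ
  simp only [f, Set.indicator]
  split_ifs with hθ
  · rw [Circle.smul_def, Real.fourierChar_apply, smul_comm]
    congr 2
    rw [circleMap_zero, Complex.ofReal_one, one_mul, ← Complex.exp_int_mul]
    congr 1
    push_cast
    field_simp
  · simp

end Resolvent

/-! ### The shift and pointwise operators on complex sequences. -/

section Sequences

open Filter Polynomial
open scoped ZeroAtInfty

variable {E : Type*} [NormedAddCommGroup E] [NormedSpace ℂ E]

/-- The translation `φ ↦ φ (· + k)` of sequences that tend to `0`. -/
def translation (E : Type*) [NormedAddCommGroup E] [NormedSpace ℂ E] (k : ℤ) :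
    C₀(ℤ, E) →L[ℂ] C₀(ℤ, E) :=
  LinearMap.mkContinuous
    { toFun := fun φ =>
        { toFun := fun n => φ (n + k)
          continuous_toFun := continuous_of_discreteTopology
          zero_at_infty' := (zero_at_infty φ).comp
            (Homeomorph.addRight k).isClosedEmbedding.tendsto_cocompact }
      map_add' := fun _ _ => rfl
      map_smul' := fun _ _ => rfl } 1 (by
    intro φ
    rw [one_mul, ← ZeroAtInftyContinuousMap.norm_toBCF_eq_norm]
    exact (BoundedContinuousFunction.norm_le (norm_nonneg _)).2 fun n =>
      φ.toBCF.norm_coe_le_norm (n + k))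

theorem norm_translation_le (k : ℤ) : ‖translation E k‖ ≤ 1 :=
  LinearMap.mkContinuous_norm_le _ zero_le_one _

/-- The translation by `1` as a unit. -/
def translationUnit (E : Type*) [NormedAddCommGroup E] [NormedSpace ℂ E] :
    (C₀(ℤ, E) →L[ℂ] C₀(ℤ, E))ˣ where
  val := translation E 1
  inv := translation E (-1)
  val_inv := by
    ext φ n
    change φ (n + 1 + -1) = φ n
    simp
  inv_val := by
    ext φ n
    change φ (n + -1 + 1) = φ n
    simp

/-- Operators of `E` acting pointwise on sequences. -/
def pointwise (E : Type*) [NormedAddCommGroup E] [NormedSpace ℂ E] :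
    (E →L[ℂ] E) →ₐ[ℂ] (C₀(ℤ, E) →L[ℂ] C₀(ℤ, E)) :=
  AlgHom.ofLinearMap
    { toFun := fun a => LinearMap.mkContinuous
        { toFun := fun φ =>
            { toFun := fun n => a (φ n)
              continuous_toFun := continuous_of_discreteTopology
              zero_at_infty' := by
                have := (a.continuous.tendsto 0).comp (zero_at_infty φ)
                rwa [map_zero] at this }
          map_add' := fun φ ψ => ZeroAtInftyContinuousMap.ext fun n => a.map_add (φ n) (ψ n)
          map_smul' := fun c φ => ZeroAtInftyContinuousMap.ext fun n => a.map_smul c (φ n) }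
        ‖a‖ (by
          intro φ
          rw [← ZeroAtInftyContinuousMap.norm_toBCF_eq_norm]
          exact (BoundedContinuousFunction.norm_le (by positivity)).2 fun n =>
            (a.le_opNorm _).trans (mul_le_mul_of_nonneg_left (φ.toBCF.norm_coe_le_norm n)
              (norm_nonneg _)))
      map_add' := fun _ _ => rfl
      map_smul' := fun _ _ => rfl }
    rfl (fun _ _ => rfl)

theorem isUnit_translation_sub_pointwise [FiniteDimensional ℂ E] {a : E →L[ℂ] E}
    (ha : ∀ z ∈ spectrum ℂ a, ‖z‖ ≠ 1) : IsUnit (translation E 1 - pointwise E a) := by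
  have := FiniteDimensional.complete ℂ E
  have hcomm : Commute (translation E 1) (pointwise E a) := by
    ext φ n
    rfl
  exact isUnit_unit_sub_algHom (A := C₀(ℤ, E) →L[ℂ] C₀(ℤ, E)) (translationUnit E) (norm_translation_le 1)
    (norm_translation_le (-1)) ContinuousLinearMap.norm_id_le ha (pointwise E) hcomm

end Sequences

/-! ### Passage between real and complex vectors and sequences. -/

section Complexification

open scoped ZeroAtInfty
open Filter

variable {d : ℕ}

/-- The inclusion `ℝᵈ → ℂᵈ`. -/
def ofRealVec (x : EuclideanSpace ℝ (Fin d)) : EuclideanSpace ℂ (Fin d) :=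
  WithLp.toLp 2 fun i => (x i : ℂ)

/-- The coordinatewise real part `ℂᵈ → ℝᵈ`. -/
def reVec (z : EuclideanSpace ℂ (Fin d)) : EuclideanSpace ℝ (Fin d) :=
  WithLp.toLp 2 fun i => (z i).re

theorem ofRealVec_apply (x : EuclideanSpace ℝ (Fin d)) (i : Fin d) : ofRealVec x i = x i := rfl

theorem reVec_apply (z : EuclideanSpace ℂ (Fin d)) (i : Fin d) : reVec z i = (z i).re := rfl

theorem reVec_ofRealVec (x : EuclideanSpace ℝ (Fin d)) : reVec (ofRealVec x) = x := rfl

theorem reVec_sub (z w : EuclideanSpace ℂ (Fin d)) : reVec (z - w) = reVec z - reVec w := rfl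

theorem ofRealVec_sub (x y : EuclideanSpace ℝ (Fin d)) :
    ofRealVec (x - y) = ofRealVec x - ofRealVec y := by
  ext i
  exact Complex.ofReal_sub _ _

theorem ofRealVec_injective : Function.Injective (ofRealVec : EuclideanSpace ℝ (Fin d) → _) :=
  Function.LeftInverse.injective reVec_ofRealVec

theorem continuous_ofRealVec : Continuous (ofRealVec (d := d)) := by
  unfold ofRealVec
  fun_prop

theorem continuous_reVec : Continuous (reVec (d := d)) := by
  unfold reVec
  fun_prop

theorem apply_eq_sum {𝕜 : Type*} [RCLike 𝕜] (M : Matrix (Fin d) (Fin d) 𝕜)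
    (x : EuclideanSpace 𝕜 (Fin d)) (i : Fin d) :
    Matrix.toEuclideanCLM (𝕜 := 𝕜) M x i = ∑ j, M i j * x j := rfl

theorem complexify_ofRealVec (a : Op d) (x : EuclideanSpace ℝ (Fin d)) :
    complexify a (ofRealVec x) = ofRealVec (a x) := by
  obtain ⟨M, rfl⟩ : ∃ M, Matrix.toEuclideanCLM (𝕜 := ℝ) M = a :=
    ⟨_, StarAlgEquiv.apply_symm_apply _ a⟩
  ext i
  rw [complexify, apply_eq_sum, ofRealVec_apply, apply_eq_sum]
  simp [ofRealVec_apply]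

theorem reVec_complexify (a : Op d) (z : EuclideanSpace ℂ (Fin d)) :
    reVec (complexify a z) = a (reVec z) := by
  obtain ⟨M, rfl⟩ : ∃ M, Matrix.toEuclideanCLM (𝕜 := ℝ) M = a :=
    ⟨_, StarAlgEquiv.apply_symm_apply _ a⟩
  ext i
  rw [complexify, reVec_apply, apply_eq_sum, apply_eq_sum]
  simp [reVec_apply]

theorem stableProjection_eq_reVec (a : Op d) (x : EuclideanSpace ℝ (Fin d)) :
    stableProjection a x = reVec (spectralProjection a (ofRealVec x)) := by
  rw [stableProjection]
  obtain ⟨M, hM⟩ : ∃ M, Matrix.toEuclideanCLM (𝕜 := ℂ) M = spectralProjection a :=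
    ⟨_, StarAlgEquiv.apply_symm_apply _ _⟩
  rw [← hM]
  ext i
  rw [reVec_apply, apply_eq_sum, apply_eq_sum]
  simp [ofRealVec_apply]

/-- The coordinatewise real part of a sequence. -/
def reSeq (φ : C₀(ℤ, EuclideanSpace ℂ (Fin d))) : SeqZero d where
  toFun n := reVec (φ n)
  continuous_toFun := continuous_of_discreteTopology
  zero_at_infty' := (continuous_reVec.tendsto 0).comp (zero_at_infty φ)

/-- A real sequence as a complex one. -/
def ofRealSeq (φ : SeqZero d) : C₀(ℤ, EuclideanSpace ℂ (Fin d)) where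
  toFun n := ofRealVec (φ n)
  continuous_toFun := continuous_of_discreteTopology
  zero_at_infty' := (continuous_ofRealVec.tendsto 0).comp (zero_at_infty φ)

end Complexification

/-! ### The Green operator of a hyperbolic matrix and its relation to the stable projection. -/

section Sequences

open Filter
open scoped ZeroAtInfty

variable {d : ℕ}

theorem norm_le_of_pointwise {T : SeqZero d →L[ℝ] SeqZero d} {C : ℝ} (hC : 0 ≤ C)
    (h : ∀ φ n, ‖T φ n‖ ≤ C * ‖φ‖) : ‖T‖ ≤ C := by
  refine T.opNorm_le_bound hC fun φ => ?_
  rw [← ZeroAtInftyContinuousMap.norm_toBCF_eq_norm]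
  exact (BoundedContinuousFunction.norm_le (by positivity)).2 fun n => h φ n

/-- Evaluation at `n`. -/
def evalAt (n : ℤ) : SeqZero d →L[ℝ] EuclideanSpace ℝ (Fin d) :=
  LinearMap.mkContinuous
    { toFun := fun φ => φ n
      map_add' := fun _ _ => rfl
      map_smul' := fun _ _ => rfl } 1 fun φ => (norm_apply_le φ n).trans (one_mul _).ge

/-- The sequence with value `x` at `-1` and `0` elsewhere. -/
def single : EuclideanSpace ℝ (Fin d) →L[ℝ] SeqZero d :=
  LinearMap.toContinuousLinearMap
    { toFun := fun x =>
        { toFun := fun n => if n = -1 then x else 0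
          continuous_toFun := continuous_of_discreteTopology
          zero_at_infty' := by
            refine tendsto_const_nhds.congr' ?_
            rw [cocompact_eq_cofinite]
            filter_upwards [(Set.finite_singleton (-1 : ℤ)).compl_mem_cofinite] with n hn
            exact (if_neg hn).symm }
      map_add' := fun x y => ZeroAtInftyContinuousMap.ext fun n => by
        change (if n = -1 then x + y else 0) = (if n = -1 then x else 0) + if n = -1 then y else 0
        split_ifs <;> simp
      map_smul' := fun c x => ZeroAtInftyContinuousMap.ext fun n => by
        change (if n = -1 then c • x else 0) = c • if n = -1 then x else 0
        split_ifs <;> simp }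

theorem single_apply (x : EuclideanSpace ℝ (Fin d)) (n : ℤ) :
    single x n = if n = -1 then x else 0 := rfl

open Classical in
/-- The operator that replaces `φ n` by `0` for all `n ∉ s`. -/
def cutoff (s : Set ℤ) : SeqZero d →L[ℝ] SeqZero d :=
  nemitski (fun n => if n ∈ s then 1 else 0) ⟨1, fun n => by
    split_ifs
    · exact ContinuousLinearMap.norm_id_le
    · simp⟩

open Classical in
theorem cutoff_of_mem {s : Set ℤ} {n : ℤ} (h : n ∈ s) (φ : SeqZero d) :
    cutoff s φ n = φ n := by
  change (if n ∈ s then (1 : Op d) else 0) (φ n) = φ n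
  rw [if_pos h]
  rfl

open Classical in
theorem cutoff_of_notMem {s : Set ℤ} {n : ℤ} (h : n ∉ s) (φ : SeqZero d) :
    cutoff s φ n = 0 := by
  change (if n ∈ s then (1 : Op d) else 0) (φ n) = 0
  rw [if_neg h]
  rfl

/-- The operator `(φ n) ↦ (φ (n + 1) - a (φ n))`. -/
def constOp (a : Op d) : SeqZero d →L[ℝ] SeqZero d :=
  shift d - nemitski (fun _ => a) ⟨‖a‖, fun _ => le_rfl⟩

theorem constOp_apply (a : Op d) (φ : SeqZero d) (n : ℤ) :
    constOp a φ n = φ (n + 1) - a (φ n) := rfl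

theorem continuous_constOp : Continuous (constOp (d := d)) := by
  refine continuous_of_norm_sub_le fun a b => ?_
  · refine norm_le_of_pointwise (norm_nonneg _) fun φ n => ?_
    have : (constOp a - constOp b) φ n = (b - a) (φ n) := by
      change (φ (n + 1) - a (φ n)) - (φ (n + 1) - b (φ n)) = b (φ n) - a (φ n)
      abel
    rw [this, norm_sub_rev a b]
    exact (b - a).le_of_opNorm_le_of_le le_rfl (norm_apply_le φ n)

/-- Bijectivity descends from `ℂ`: real sequences embed into complex ones, and since `a` is real the
real part of a complex solution with real right-hand side is again a solution. -/
theorem isUnit_constOp {a : Op d} (ha : IsHyperbolic a) : IsUnit (constOp a) := by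
  have hu := isUnit_translation_sub_pointwise ha
  set T := translation (EuclideanSpace ℂ (Fin d)) 1 - pointwise _ (complexify a) with hT
  have hTa : ∀ φ n, T φ n = φ (n + 1) - complexify a (φ n) := fun _ _ => rfl
  have hbij := ContinuousLinearMap.isUnit_iff_bijective.1 hu
  rw [ContinuousLinearMap.isUnit_iff_bijective]
  constructor
  · rw [injective_iff_map_eq_zero]
    intro φ hφ
    have h : T (ofRealSeq φ) = 0 := by
      ext1 n
      have := congrArg ofRealVec (DFunLike.congr_fun hφ n)
      rw [hTa]
      change ofRealVec (φ (n + 1)) - complexify a (ofRealVec (φ n)) = 0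
      rw [complexify_ofRealVec, ← ofRealVec_sub]
      exact this
    have h0 := hbij.1 (h.trans (map_zero T).symm)
    ext1 n
    exact ofRealVec_injective (DFunLike.congr_fun h0 n)
  · intro y
    obtain ⟨ψ, hψ⟩ := hbij.2 (ofRealSeq y)
    refine ⟨reSeq ψ, ?_⟩
    ext1 n
    have := congrArg reVec (DFunLike.congr_fun hψ n)
    rw [hTa, reVec_sub, reVec_complexify] at this
    exact this

/-- The inverse of `constOp a`. -/
def green (a : Op d) : SeqZero d →L[ℝ] SeqZero d := Ring.inverse (constOp a)

theorem constOp_green {a : Op d} (ha : IsHyperbolic a) (y : SeqZero d) :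
    constOp a (green a y) = y :=
  DFunLike.congr_fun (Ring.mul_inverse_cancel _ (isUnit_constOp ha)) y

theorem green_constOp {a : Op d} (ha : IsHyperbolic a) (φ : SeqZero d) :
    green a (constOp a φ) = φ :=
  DFunLike.congr_fun (Ring.inverse_mul_cancel _ (isUnit_constOp ha)) φ

theorem green_succ {a : Op d} (ha : IsHyperbolic a) (y : SeqZero d) (n : ℤ) :
    green a y (n + 1) = a (green a y n) + y n := by
  conv_rhs => rw [← constOp_green ha y, constOp_apply, green_constOp ha]
  abel

theorem continuous_green {B : Type*} [TopologicalSpace B] {a : B → Op d} (hac : Continuous a)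
    (ha : ∀ b, IsHyperbolic (a b)) : Continuous fun b => green (a b) := by
  exact continuous_ringInverse (continuous_constOp.comp hac) fun b => isUnit_constOp (ha b)

/-- The real part of the sequence of Laurent coefficients applied to `x` tends to `0` and is mapped
by `constOp a` to `single x`; by injectivity it is `green a (single x)`. Its value at `0` is the
contour integral that defines the projection. -/
theorem stableProjection_apply {a : Op d} (ha : IsHyperbolic a) (x : EuclideanSpace ℝ (Fin d)) :
    stableProjection a x = green a (single x) 0 := by
  let ψ : C₀(ℤ, EuclideanSpace ℂ (Fin d)) :=
    { toFun := fun n => resolventCoeff (complexify a) n (ofRealVec x)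
      continuous_toFun := continuous_of_discreteTopology
      zero_at_infty' := by
        have := ((ContinuousLinearMap.apply ℂ (EuclideanSpace ℂ (Fin d))
          (ofRealVec x)).continuous.tendsto 0).comp (tendsto_resolventCoeff (complexify a))
        rwa [map_zero] at this }
  have hψ : ∀ n, ψ n = resolventCoeff (complexify a) n (ofRealVec x) := fun _ => rfl
  have h : constOp a (reSeq ψ) = single x := by
    ext1 n
    have := congrArg (fun T => reVec (T (ofRealVec x))) (resolventCoeff_succ_sub ha n)
    rw [constOp_apply]
    change reVec (ψ (n + 1)) - a (reVec (ψ n)) = _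
    rw [← reVec_complexify, ← reVec_sub, single_apply]
    refine Eq.trans this ?_
    split_ifs
    · exact reVec_ofRealVec x
    · rfl
  rw [← h, green_constOp ha, stableProjection_eq_reVec]
  change _ = reVec (ψ 0)
  rw [hψ, resolventCoeff, spectralProjection]
  simp only [zpow_zero, one_smul]

/-- Continuity of the projection in `a` thereby follows from continuity of operator inversion. -/
theorem stableProjection_eq {a : Op d} (ha : IsHyperbolic a) :
    stableProjection a = evalAt 0 ∘L green a ∘L single :=
  ContinuousLinearMap.ext fun x => stableProjection_apply ha x

/-- The truncation of `φ` to `n ≥ 0` solves the equation everywhere except at `n = -1`, where the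
jump is `φ 0 - a 0`. -/
theorem green_single_of_forward {a : Op d} (ha : IsHyperbolic a) {φ : SeqZero d}
    (h : ∀ n, 0 ≤ n → φ (n + 1) = a (φ n)) : green a (single (φ 0)) = cutoff (Set.Ici 0) φ := by
  rw [← green_constOp ha (cutoff (Set.Ici 0) φ)]
  congr 1
  ext1 n
  rw [constOp_apply, single_apply]
  rcases lt_trichotomy n (-1) with hn | rfl | hn
  · rw [if_neg hn.ne, cutoff_of_notMem (by simp; omega), cutoff_of_notMem (by simp; omega)]
    simp
  · rw [if_pos rfl, cutoff_of_mem (by simp), cutoff_of_notMem (by simp)]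
    simp
  · rw [if_neg hn.ne', cutoff_of_mem (by simp; omega), cutoff_of_mem (by simp; omega),
      h n (by omega), sub_self]

/-- The truncation of `φ` to `n < 0` has its only jump at `n = -1`, where it is `0 - a (φ (-1))`;
hence the sign. -/
theorem green_single_of_backward {a : Op d} (ha : IsHyperbolic a) {φ : SeqZero d}
    (h : ∀ n, n < -1 → φ (n + 1) = a (φ n)) :
    green a (single (a (φ (-1)))) = -cutoff (Set.Iio 0) φ := by
  rw [← green_constOp ha (-cutoff (Set.Iio 0) φ)]
  congr 1
  ext1 n
  rw [map_neg (constOp a)]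
  change _ = -(constOp a (cutoff (Set.Iio 0) φ) n)
  rw [constOp_apply, single_apply]
  rcases lt_trichotomy n (-1) with hn | rfl | hn
  · rw [if_neg hn.ne, cutoff_of_mem (by simp; omega), cutoff_of_mem (by simp; omega), h n hn]
    simp
  · rw [if_pos rfl, cutoff_of_notMem (by simp), cutoff_of_mem (by simp)]
    simp
  · rw [if_neg hn.ne', cutoff_of_notMem (by simp; omega), cutoff_of_notMem (by simp; omega)]
    simp

theorem stableProjection_of_forward {a : Op d} (ha : IsHyperbolic a) {φ : SeqZero d}
    (h : ∀ n, 0 ≤ n → φ (n + 1) = a (φ n)) : stableProjection a (φ 0) = φ 0 := by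
  rw [stableProjection_apply ha, green_single_of_forward ha h, cutoff_of_mem (by simp)]

theorem stableProjection_of_backward {a : Op d} (ha : IsHyperbolic a) {φ : SeqZero d}
    (h : ∀ n, n < -1 → φ (n + 1) = a (φ n)) : stableProjection a (a (φ (-1))) = 0 := by
  rw [stableProjection_apply ha, green_single_of_backward ha h]
  change -(cutoff (Set.Iio 0) φ 0) = 0
  rw [cutoff_of_notMem (by simp), neg_zero]

theorem green_single_succ {a : Op d} (ha : IsHyperbolic a) (x : EuclideanSpace ℝ (Fin d))
    {n : ℤ} (hn : n ≠ -1) : green a (single x) (n + 1) = a (green a (single x) n) := by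
  rw [green_succ ha, single_apply, if_neg hn, add_zero]

theorem stableProjection_idem {a : Op d} (ha : IsHyperbolic a) (x : EuclideanSpace ℝ (Fin d)) :
    stableProjection a (stableProjection a x) = stableProjection a x := by
  rw [stableProjection_apply ha x]
  -- `green a (single x)` is itself a decaying forward solution from index `0` on, so its value
  -- there is fixed.
  exact stableProjection_of_forward ha fun n hn => green_single_succ ha x (by omega)

theorem isProjectionFamily_stableProjection {B : Type*} [TopologicalSpace B] {a : B → Op d}
    (hac : Continuous a) (ha : ∀ b, IsHyperbolic (a b)) :
    IsProjectionFamily fun b => stableProjection (a b) := by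
  refine ⟨?_, fun b => ?_, fun b => inferInstance⟩
  · rw [show (fun b => stableProjection (a b)) = fun b => evalAt 0 ∘L green (a b) ∘L single from
      funext fun b => stableProjection_eq (ha b)]
    exact continuous_comp_comp (continuous_green hac ha) (evalAt 0) single
  · ext1 x
    rw [ContinuousLinearMap.comp_apply, stableProjection_idem (ha b)]

end Sequences

/-! ### Families that agree up to invertible operators and a finite-dimensional subspace. -/

section Perturbation

variable {B : Type*} [TopologicalSpace B] {X Y : Type}
  [NormedAddCommGroup X] [NormedSpace ℝ X] [CompleteSpace X]
  [NormedAddCommGroup Y] [NormedSpace ℝ Y] [CompleteSpace Y]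

omit [CompleteSpace X] [CompleteSpace Y] in
theorem continuous_of_eventually_norm_sub_le {F : B → X →L[ℝ] Y}
    (h : ∀ b, ∀ ε > 0, ∀ᶠ c in 𝓝 b, ‖F c - F b‖ ≤ ε) : Continuous F := by
  rw [continuous_iff_continuousAt]
  intro b
  refine Metric.tendsto_nhds.2 fun ε hε => ?_
  filter_upwards [h b (ε / 2) (half_pos hε)] with c hc
  rw [dist_eq_norm]
  exact hc.trans_lt (half_lt_self hε)

omit [CompleteSpace X] [CompleteSpace Y] in
theorem exists_norm_le [CompactSpace B] {F : B → X →L[ℝ] Y} (hF : Continuous F) :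
    ∃ C > 0, ∀ b, ‖F b‖ ≤ C := by
  obtain ⟨C, hC⟩ := isCompact_univ.exists_bound_of_continuousOn hF.continuousOn
  exact ⟨max C 1, by positivity, fun b => (hC b trivial).trans (le_max_left _ _)⟩

omit [CompleteSpace Y] in
theorem isUnit_one_sub_comp {R : Y →L[ℝ] X} {D : X →L[ℝ] Y} {C : ℝ} (hC : 0 < C) (hR : ‖R‖ ≤ C)
    (hD : ‖D‖ ≤ (2 * C)⁻¹) : IsUnit (1 - R ∘L D) := by
  refine isUnit_one_sub_of_norm_lt_one ?_
  refine (R.opNorm_comp_le D).trans_lt ?_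
  refine (mul_le_mul hR hD (norm_nonneg _) hC.le).trans_lt ?_
  rw [mul_inv, mul_left_comm, mul_inv_cancel₀ hC.ne']
  norm_num

omit [CompleteSpace X] [CompleteSpace Y] in
theorem continuous_one_sub_comp {R : B → Y →L[ℝ] X} {K : Y →L[ℝ] Y} {F G : B → X →L[ℝ] Y}
    (hR : Continuous R) (hF : Continuous F) (hG : Continuous G) :
    Continuous fun b => 1 - R b ∘L (K ∘L (F b - G b)) :=
  continuous_const.sub (hR.clm_comp (continuous_const.clm_comp (hF.sub hG)))

omit [CompleteSpace X] in
theorem inverse_apply_apply {T : X →L[ℝ] X} (h : IsUnit T) (x : X) : Ring.inverse T (T x) = x :=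
  DFunLike.congr_fun (Ring.inverse_mul_cancel T h) x

omit [CompleteSpace X] in
theorem apply_inverse_apply {T : X →L[ℝ] X} (h : IsUnit T) (x : X) : T (Ring.inverse T x) = x :=
  DFunLike.congr_fun (Ring.mul_inverse_cancel T h) x

variable {L M : B → X →L[ℝ] Y} {T : B → X →L[ℝ] X} {V : Submodule ℝ Y}

omit [TopologicalSpace B] [CompleteSpace X] [CompleteSpace Y] in
theorem mem_iff_of_sub_mem (h : ∀ b x, L b x - M b (T b x) ∈ V) (b : B) (x : X) :
    L b x ∈ V ↔ M b (T b x) ∈ V :=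
  ⟨fun hx => by simpa using V.sub_mem hx (h b x), fun hx => by simpa using V.add_mem (h b x) hx⟩

omit [CompleteSpace X] [CompleteSpace Y] in
/-- A family that agrees modulo `V` with a Fredholm family, up to invertible operators, is
Fredholm. -/
theorem IsFredholmFamily.of_sub_mem [FiniteDimensional ℝ V] (hM : IsFredholmFamily M)
    (hL : Continuous L) (hT : ∀ b, IsUnit (T b)) (h : ∀ b x, L b x - M b (T b x) ∈ V)
    {R : B → Y →L[ℝ] X} (hR : ∀ b y, M b (R b y) - y ∈ V) : IsFredholmFamily L := by
  -- Modulo `V`, `L T⁻¹ R ≡ M R ≡ 1`, and `T` embeds `L⁻¹(V)` into the finite-dimensional `M⁻¹(V)`.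
  refine ⟨hL, fun b => isFredholm_of_rightInverse_mod (Ring.inverse (T b) ∘L R b) V ?_ fun y => ?_⟩
  · have : FiniteDimensional ℝ (LinearMap.ker (M b : X →ₗ[ℝ] Y)) := (hM.isFredholm b).finite_ker
    have hfin : FiniteDimensional ℝ (V.comap (M b : X →ₗ[ℝ] Y)) := inferInstance
    let f : V.comap (L b : X →ₗ[ℝ] Y) →ₗ[ℝ] V.comap (M b : X →ₗ[ℝ] Y) :=
      ((T b : X →ₗ[ℝ] X).comp (Submodule.subtype _)).codRestrict _ fun x =>
        (mem_iff_of_sub_mem h b x).1 x.2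
    refine FiniteDimensional.of_injective f fun x y hxy => Subtype.ext ?_
    have := congrArg (fun z : V.comap (M b : X →ₗ[ℝ] Y) => Ring.inverse (T b) (z : X)) hxy
    exact (inverse_apply_apply (hT b) _).symm.trans (this.trans (inverse_apply_apply (hT b) _))
  · have h1 := h b (Ring.inverse (T b) (R b y))
    rw [apply_inverse_apply (hT b)] at h1
    simpa using V.add_mem h1 (hR b y)

/-- Families that agree modulo `V`, up to invertible operators, have the same index class. -/
theorem indexClass_eq_of_sub_mem [ConnectedSpace B] (hL : IsFredholmFamily L)
    (hM : IsFredholmFamily M) (hT : Continuous T) (hTu : ∀ b, IsUnit (T b))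
    (h : ∀ b x, L b x - M b (T b x) ∈ V) (hV : IsTransversal L V) (hV' : IsTransversal M V) :
    indexClass hL hV = indexClass hM hV' := by
  have hiso := (hV.isLocallyTrivial hL).bundle_iso (hV'.isLocallyTrivial hM) T hT
    (fun b => Ring.inverse (T b)) (continuous_ringInverse hT hTu)
    (fun b x hx => (mem_iff_of_sub_mem h b x).1 hx)
    (fun b x hx => by
      refine (mem_iff_of_sub_mem h b _).2 ?_
      rw [apply_inverse_apply (hTu b)]
      exact hx)
    (fun b x _ => inverse_apply_apply (hTu b) x) (fun b x _ => apply_inverse_apply (hTu b) x)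
  have := RealBundle.toKO_eq_of_iso hiso
  rw [indexClass, indexClass, kernelBundle, kernelBundle, this]

end Perturbation

/-! ### The model operator with one hyperbolic matrix on each half-line. -/

section Model

variable {d : ℕ}

/-- The sequences that vanish outside `s`. -/
def supportedIn (d : ℕ) (s : Set ℤ) : Submodule ℝ (SeqZero d) where
  carrier := {φ | ∀ n ∉ s, φ n = 0}
  add_mem' {φ ψ} hφ hψ n hn := by
    change φ n + ψ n = 0
    rw [hφ n hn, hψ n hn, add_zero]
  zero_mem' _ _ := rfl
  smul_mem' c φ hφ n hn := by
    change c • φ n = 0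
    rw [hφ n hn, smul_zero]

theorem mem_supportedIn {s : Set ℤ} {φ : SeqZero d} :
    φ ∈ supportedIn d s ↔ ∀ n ∉ s, φ n = 0 := Iff.rfl

theorem supportedIn_mono {s t : Set ℤ} (h : s ⊆ t) : supportedIn d s ≤ supportedIn d t :=
  fun _ hφ n hn => hφ n fun hs => hn (h hs)

theorem finiteDimensional_supportedIn {s : Set ℤ} (hs : s.Finite) :
    FiniteDimensional ℝ (supportedIn d s) := by
  have := hs.to_subtype
  let f : supportedIn d s →ₗ[ℝ] s → EuclideanSpace ℝ (Fin d) :=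
    { toFun := fun φ n => φ.1 n
      map_add' := fun _ _ => rfl
      map_smul' := fun _ _ => rfl }
  refine FiniteDimensional.of_injective f fun φ ψ h => Subtype.ext ?_
  ext1 n
  by_cases hn : n ∈ s
  · exact congrFun h ⟨n, hn⟩
  · rw [φ.2 n hn, ψ.2 n hn]

theorem single_mem_supportedIn (x : EuclideanSpace ℝ (Fin d)) :
    single x ∈ supportedIn d {-1} := fun n hn => by
  rw [single_apply, if_neg (by simpa using hn)]

theorem single_apply_neg_one {φ : SeqZero d} (hφ : φ ∈ supportedIn d {-1}) :
    single (φ (-1)) = φ := by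
  ext1 n
  rw [single_apply]
  split_ifs with hn
  · rw [hn]
  · exact (hφ n hn).symm

/-- The operator `φ ↦ (φ (n + 1) - p (φ n))` for `n ≥ 0` and `φ ↦ (φ (n + 1) - q (φ n))` for
`n < 0`. -/
def modelOp (p q : Op d) : SeqZero d →L[ℝ] SeqZero d :=
  cutoff (Set.Ici 0) ∘L constOp p + cutoff (Set.Iio 0) ∘L constOp q

theorem modelOp_of_nonneg (p q : Op d) (φ : SeqZero d) {n : ℤ} (hn : 0 ≤ n) :
    modelOp p q φ n = φ (n + 1) - p (φ n) := by
  change cutoff (Set.Ici 0) (constOp p φ) n + cutoff (Set.Iio 0) (constOp q φ) n = _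
  rw [cutoff_of_mem (Set.mem_Ici.2 hn), cutoff_of_notMem (by simpa using hn), add_zero,
    constOp_apply]

theorem modelOp_of_neg (p q : Op d) (φ : SeqZero d) {n : ℤ} (hn : n < 0) :
    modelOp p q φ n = φ (n + 1) - q (φ n) := by
  change cutoff (Set.Ici 0) (constOp p φ) n + cutoff (Set.Iio 0) (constOp q φ) n = _
  rw [cutoff_of_notMem (by simpa using hn), cutoff_of_mem (Set.mem_Iio.2 hn), zero_add,
    constOp_apply]

/-- The sequence that agrees with `φ` on `n ≥ 0` and with `ψ` on `n < 0`. -/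
def glue (φ ψ : SeqZero d) : SeqZero d := cutoff (Set.Ici 0) φ + cutoff (Set.Iio 0) ψ

theorem glue_of_nonneg (φ ψ : SeqZero d) {n : ℤ} (hn : 0 ≤ n) : glue φ ψ n = φ n := by
  change cutoff (Set.Ici 0) φ n + cutoff (Set.Iio 0) ψ n = _
  rw [cutoff_of_mem (Set.mem_Ici.2 hn), cutoff_of_notMem (by simpa using hn), add_zero]

theorem glue_of_neg (φ ψ : SeqZero d) {n : ℤ} (hn : n < 0) : glue φ ψ n = ψ n := by
  change cutoff (Set.Ici 0) φ n + cutoff (Set.Iio 0) ψ n = _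
  rw [cutoff_of_notMem (by simpa using hn), cutoff_of_mem (Set.mem_Iio.2 hn), zero_add]

/-- The indices `n` and `n + 1` lie on the same side of the cut unless `n = -1`. All defects of
gluing are therefore confined to `supportedIn d {-1}`. -/
theorem modelOp_glue (p q : Op d) (φ ψ : SeqZero d) {n : ℤ} (hn : n ≠ -1) :
    modelOp p q (glue φ ψ) n = glue (constOp p φ) (constOp q ψ) n := by
  rcases lt_or_ge n 0 with h | h
  · rw [modelOp_of_neg _ _ _ h, glue_of_neg _ _ h, glue_of_neg _ _ (by omega), glue_of_neg _ _ h,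
      constOp_apply]
  · rw [modelOp_of_nonneg _ _ _ h, glue_of_nonneg _ _ h, glue_of_nonneg _ _ (by omega),
      glue_of_nonneg _ _ h, constOp_apply]

theorem glue_self (φ : SeqZero d) : glue φ φ = φ := by
  ext1 n
  rcases lt_or_ge n 0 with h | h
  · rw [glue_of_neg _ _ h]
  · rw [glue_of_nonneg _ _ h]

/-- A right inverse of `modelOp p q` modulo the sequences supported at `-1`. -/
def modelInverse (p q : Op d) : SeqZero d →L[ℝ] SeqZero d :=
  cutoff (Set.Ici 0) ∘L green p + cutoff (Set.Iio 0) ∘L green q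

theorem modelInverse_apply (p q : Op d) (y : SeqZero d) :
    modelInverse p q y = glue (green p y) (green q y) := rfl

variable {p q : Op d}

theorem modelOp_modelInverse_sub_mem (hp : IsHyperbolic p) (hq : IsHyperbolic q) (y : SeqZero d) :
    modelOp p q (modelInverse p q y) - y ∈ supportedIn d {-1} := by
  intro n hn
  change modelOp p q (modelInverse p q y) n - y n = 0
  rw [modelInverse_apply, modelOp_glue _ _ _ _ hn, constOp_green hp, constOp_green hq, glue_self,
    sub_self]

theorem forward_of_modelOp_mem {φ : SeqZero d} (h : modelOp p q φ ∈ supportedIn d {-1})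
    (n : ℤ) (hn : 0 ≤ n) : φ (n + 1) = p (φ n) := by
  have h1 : modelOp p q φ n = 0 := h n (by rintro rfl; omega)
  rwa [modelOp_of_nonneg _ _ _ hn, sub_eq_zero] at h1

theorem backward_of_modelOp_mem {φ : SeqZero d} (h : modelOp p q φ ∈ supportedIn d {-1})
    (n : ℤ) (hn : n < -1) : φ (n + 1) = q (φ n) := by
  have h1 : modelOp p q φ n = 0 := h n (by rintro rfl; omega)
  rwa [modelOp_of_neg _ _ _ (by omega), sub_eq_zero] at h1

/-- The solutions of the model equation outside `-1` are determined by their boundary values. -/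
theorem eq_glue_of_modelOp_mem (hp : IsHyperbolic p) (hq : IsHyperbolic q) {φ : SeqZero d}
    (h : modelOp p q φ ∈ supportedIn d {-1}) :
    glue (green p (single (φ 0))) (-green q (single (q (φ (-1))))) = φ := by
  rw [green_single_of_forward hp (forward_of_modelOp_mem h),
    green_single_of_backward hq (backward_of_modelOp_mem h), neg_neg]
  ext1 n
  rcases lt_or_ge n 0 with hn | hn
  · rw [glue_of_neg _ _ hn, cutoff_of_mem (Set.mem_Iio.2 hn)]
  · rw [glue_of_nonneg _ _ hn, cutoff_of_mem (Set.mem_Ici.2 hn)]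

theorem modelOp_glue_green_mem (hp : IsHyperbolic p) (hq : IsHyperbolic q)
    (x y : EuclideanSpace ℝ (Fin d)) :
    modelOp p q (glue (green p (single x)) (-green q (single y))) ∈ supportedIn d {-1} := by
  intro n hn
  rw [modelOp_glue _ _ _ _ hn, map_neg (constOp q), constOp_green hp, constOp_green hq]
  have h1 : single x n = 0 := single_mem_supportedIn x n hn
  have h2 : (-single y) n = 0 := (supportedIn d {-1}).neg_mem (single_mem_supportedIn y) n hn
  rcases lt_or_ge n 0 with h | h
  · rw [glue_of_neg _ _ h, h2]
  · rw [glue_of_nonneg _ _ h, h1]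

/-- This is the recursion for `green` across the index `-1`. It shows why the boundary value of the
backward half is taken as `q (φ (-1))`: that vector ranges over `ker Pˢ_q` even if `q` is not
invertible. -/
theorem boundary_neg_green (hq : IsHyperbolic q) (y : EuclideanSpace ℝ (Fin d)) :
    q (-(green q (single y) (-1))) = y - stableProjection q y := by
  have := green_succ hq (single y) (-1)
  rw [single_apply, if_pos rfl, show (-1 + 1 : ℤ) = 0 by norm_num,
    ← stableProjection_apply hq] at this
  rw [this, map_neg q]
  abel

/-- The boundary values `(φ 0, q (φ (-1)))` of `φ`. -/
def boundary (q : Op d) :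
    SeqZero d →L[ℝ] EuclideanSpace ℝ (Fin d) × EuclideanSpace ℝ (Fin d) :=
  (evalAt 0).prod (q ∘L evalAt (-1))

theorem boundary_apply (q : Op d) (φ : SeqZero d) : boundary q φ = (φ 0, q (φ (-1))) := rfl

/-- The solution of the model equation outside `-1` with given boundary values. -/
def solution (p q : Op d) :
    EuclideanSpace ℝ (Fin d) × EuclideanSpace ℝ (Fin d) →L[ℝ] SeqZero d :=
  cutoff (Set.Ici 0) ∘L green p ∘L (single ∘L ContinuousLinearMap.fst ℝ _ _) +
    cutoff (Set.Iio 0) ∘L green q ∘L (single ∘L (-ContinuousLinearMap.snd ℝ _ _))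

theorem solution_apply (p q : Op d) (x y : EuclideanSpace ℝ (Fin d)) :
    solution p q (x, y) = glue (green p (single x)) (-green q (single y)) := by
  rw [← map_neg (green q), ← map_neg single]
  rfl

theorem solution_boundary (hp : IsHyperbolic p) (hq : IsHyperbolic q) {φ : SeqZero d}
    (h : modelOp p q φ ∈ supportedIn d {-1}) : solution p q (boundary q φ) = φ := by
  rw [boundary_apply, solution_apply, eq_glue_of_modelOp_mem hp hq h]

theorem boundary_solution (hp : IsHyperbolic p) (hq : IsHyperbolic q)
    {x y : EuclideanSpace ℝ (Fin d)} (hx : stableProjection p x = x)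
    (hy : stableProjection q y = 0) : boundary q (solution p q (x, y)) = (x, y) := by
  rw [boundary_apply, solution_apply, glue_of_nonneg _ _ le_rfl, glue_of_neg _ _ (by norm_num),
    ← stableProjection_apply hp, hx]
  change (x, q (-(green q (single y) (-1)))) = (x, y)
  rw [boundary_neg_green hq, hy, sub_zero]

theorem finiteDimensional_comap_modelOp (hp : IsHyperbolic p) (hq : IsHyperbolic q) :
    FiniteDimensional ℝ
      ((supportedIn d {-1}).comap (modelOp p q : SeqZero d →ₗ[ℝ] SeqZero d)) := by
  let f : (supportedIn d {-1}).comap (modelOp p q : SeqZero d →ₗ[ℝ] SeqZero d) →ₗ[ℝ]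
      EuclideanSpace ℝ (Fin d) × EuclideanSpace ℝ (Fin d) :=
    { toFun := fun φ => (φ.1 0, φ.1 (-1))
      map_add' := fun _ _ => rfl
      map_smul' := fun _ _ => rfl }
  refine FiniteDimensional.of_injective f ?_
  rintro ⟨φ, hφ⟩ ⟨ψ, hψ⟩ h
  refine Subtype.ext ?_
  change φ = ψ
  have h0 : φ 0 = ψ 0 := congrArg Prod.fst h
  have h1 : φ (-1) = ψ (-1) := congrArg Prod.snd h
  rw [← eq_glue_of_modelOp_mem hp hq hφ, ← eq_glue_of_modelOp_mem hp hq hψ, h0, h1]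

end Model

/-! ### The index class of a family of model operators. -/

section ModelFamily

variable {B : Type*} [TopologicalSpace B] {d : ℕ} {p q : B → Op d}

theorem IsProjectionFamily.one_sub {X : Type} [NormedAddCommGroup X] [NormedSpace ℝ X]
    [FiniteDimensional ℝ X] {P : B → X →L[ℝ] X} (hP : IsProjectionFamily P) :
    IsProjectionFamily fun b => 1 - P b := by
  refine ⟨continuous_const.sub hP.continuous, fun b => ?_, fun b => inferInstance⟩
  have h : P b * P b = P b := hP.idem b
  change (1 - P b) * (1 - P b) = 1 - P b
  rw [mul_sub, sub_mul, sub_mul, h]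
  simp

theorem continuous_modelOp (hp : Continuous p) (hq : Continuous q) :
    Continuous fun b => modelOp (p b) (q b) :=
  (continuous_comp_comp (continuous_constOp.comp hp) (cutoff (Set.Ici 0)) (.id ℝ _)).add
    (continuous_comp_comp (continuous_constOp.comp hq) (cutoff (Set.Iio 0)) (.id ℝ _))

theorem continuous_modelInverse (hp : Continuous p) (hq : Continuous q)
    (hph : ∀ b, IsHyperbolic (p b)) (hqh : ∀ b, IsHyperbolic (q b)) :
    Continuous fun b => modelInverse (p b) (q b) :=
  (continuous_comp_comp (continuous_green hp hph) (cutoff (Set.Ici 0)) (.id ℝ _)).add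
    (continuous_comp_comp (continuous_green hq hqh) (cutoff (Set.Iio 0)) (.id ℝ _))

theorem continuous_boundary (hq : Continuous q) : Continuous fun b => boundary (q b) :=
  continuous_clm_prod continuous_const
    (continuous_comp_comp hq (.id ℝ (EuclideanSpace ℝ (Fin d))) (evalAt (-1)))

theorem continuous_solution (hp : Continuous p) (hq : Continuous q)
    (hph : ∀ b, IsHyperbolic (p b)) (hqh : ∀ b, IsHyperbolic (q b)) :
    Continuous fun b => solution (p b) (q b) := by
  have h1 := continuous_comp_comp (continuous_green hp hph) (cutoff (Set.Ici 0))
    (single ∘L ContinuousLinearMap.fst ℝ (EuclideanSpace ℝ (Fin d)) (EuclideanSpace ℝ (Fin d)))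
  have h2 := continuous_comp_comp (continuous_green hq hqh) (cutoff (Set.Iio 0))
    (single ∘L (-ContinuousLinearMap.snd ℝ (EuclideanSpace ℝ (Fin d)) (EuclideanSpace ℝ (Fin d))))
  exact h1.add h2

theorem isFredholmFamily_modelOp (hp : Continuous p) (hq : Continuous q)
    (hph : ∀ b, IsHyperbolic (p b)) (hqh : ∀ b, IsHyperbolic (q b)) :
    IsFredholmFamily fun b => modelOp (p b) (q b) := by
  have := finiteDimensional_supportedIn (d := d) (Set.finite_singleton (-1 : ℤ))
  exact ⟨continuous_modelOp hp hq, fun b => isFredholm_of_rightInverse_mod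
    (modelInverse (p b) (q b)) (supportedIn d {-1})
    (finiteDimensional_comap_modelOp (hph b) (hqh b))
    (modelOp_modelInverse_sub_mem (hph b) (hqh b))⟩

theorem mem_range_stableProjection_iff {a : Op d} (ha : IsHyperbolic a)
    {x : EuclideanSpace ℝ (Fin d)} :
    x ∈ (stableProjection a).range ↔ stableProjection a x = x :=
  ⟨by rintro ⟨y, rfl⟩; exact stableProjection_idem ha y, fun h => ⟨x, h⟩⟩

theorem mem_range_one_sub_stableProjection_iff {a : Op d} (ha : IsHyperbolic a)
    {x : EuclideanSpace ℝ (Fin d)} :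
    x ∈ (1 - stableProjection a).range ↔ stableProjection a x = 0 := by
  constructor
  · rintro ⟨y, rfl⟩
    change stableProjection a (y - stableProjection a y) = 0
    rw [map_sub (stableProjection a), stableProjection_idem ha, sub_self]
  · intro h
    refine ⟨x, ?_⟩
    change x - stableProjection a x = x
    rw [h, sub_zero]

/-- Initial values of forward solutions together with final values of backward solutions
parametrize the solutions of the model equation outside `-1`. -/
theorem toKO_kernelBundle_modelOp [ConnectedSpace B] (hp : Continuous p) (hq : Continuous q)
    (hph : ∀ b, IsHyperbolic (p b)) (hqh : ∀ b, IsHyperbolic (q b))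
    (hM : IsFredholmFamily fun b => modelOp (p b) (q b))
    (hV : IsTransversal (fun b => modelOp (p b) (q b)) (supportedIn d {-1}))
    (hP : IsProjectionFamily fun b => stableProjection (p b))
    (hQ : IsProjectionFamily fun b => 1 - stableProjection (q b)) :
    (kernelBundle hM hV).toKO = (imageBundle hP).toKO + (imageBundle hQ).toKO := by
  have hE := hV.isLocallyTrivial hM
  have hI := hP.isLocallyTrivial.prod hQ.isLocallyTrivial
  have hiso : hE.bundle.Iso hI.bundle := by
    refine hE.bundle_iso hI (fun b => boundary (q b)) (continuous_boundary hq)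
      (fun b => solution (p b) (q b)) (continuous_solution hp hq hph hqh) ?_ ?_ ?_ ?_
    · intro b φ hφ
      exact ⟨(mem_range_stableProjection_iff (hph b)).2
          (stableProjection_of_forward (hph b) (forward_of_modelOp_mem hφ)),
        (mem_range_one_sub_stableProjection_iff (hqh b)).2
          (stableProjection_of_backward (hqh b) (backward_of_modelOp_mem hφ))⟩
    · rintro b ⟨x, y⟩ -
      change modelOp (p b) (q b) (solution (p b) (q b) (x, y)) ∈ supportedIn d {-1}
      rw [solution_apply]
      exact modelOp_glue_green_mem (hph b) (hqh b) x y
    · exact fun b φ hφ => solution_boundary (hph b) (hqh b) hφ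
    · rintro b ⟨x, y⟩ ⟨hx, hy⟩
      exact boundary_solution (hph b) (hqh b) ((mem_range_stableProjection_iff (hph b)).1 hx)
        ((mem_range_one_sub_stableProjection_iff (hqh b)).1 hy)
  have h := RealBundle.toKO_eq_of_iso hiso
  rw [hP.isLocallyTrivial.toKO_prod hQ.isLocallyTrivial] at h
  exact h

/-- Evaluation at `-1` identifies the sequences supported there with `ℝᵈ`, which splits as `im (1 -
Q b) ⊕ im (Q b)`. -/
theorem toKO_image_one_sub_add [ConnectedSpace B]
    {Q : B → Op d} (hQ : IsProjectionFamily Q) (hQ' : IsProjectionFamily fun b => 1 - Q b)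
    [FiniteDimensional ℝ (supportedIn d {-1})] :
    (imageBundle hQ').toKO + (imageBundle hQ).toKO =
      (RealBundle.trivial B (supportedIn d {-1})).toKO := by
  rw [imageBundle, imageBundle, ← hQ'.isLocallyTrivial.toKO_prod hQ.isLocallyTrivial,
    ← RealBundle.toKO_eq_of_iso (bundle_const_iso (supportedIn d {-1}))]
  have hid : ∀ b x, Q b (Q b x) = Q b x := fun b x => DFunLike.congr_fun (hQ.idem b) x
  have hI := hQ'.isLocallyTrivial.prod hQ.isLocallyTrivial
  have hV := isLocallyTrivial_const (B := B) (supportedIn d {-1})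
  refine RealBundle.toKO_eq_of_iso (hI.bundle_iso hV
    (fun b => single ∘L (ContinuousLinearMap.fst ℝ _ _ + ContinuousLinearMap.snd ℝ _ _))
    continuous_const
    (fun b => ((1 - Q b) ∘L evalAt (-1)).prod (Q b ∘L evalAt (-1)))
    (continuous_clm_prod (continuous_comp_comp hQ'.continuous (.id ℝ _) (evalAt (-1)))
      (continuous_comp_comp hQ.continuous (.id ℝ _) (evalAt (-1)))) ?_ ?_ ?_ ?_)
  · exact fun b x _ => single_mem_supportedIn _
  · exact fun b φ _ => ⟨⟨φ (-1), rfl⟩, ⟨φ (-1), rfl⟩⟩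
  · rintro b ⟨_, _⟩ ⟨⟨x, rfl⟩, ⟨y, rfl⟩⟩
    change ((1 - Q b) ((1 - Q b) x + Q b y), Q b ((1 - Q b) x + Q b y)) = ((1 - Q b) x, Q b y)
    simp [hid]
  · intro b φ hφ
    change single (φ (-1) - Q b (φ (-1)) + Q b (φ (-1))) = φ
    rw [sub_add_cancel, single_apply_neg_one hφ]

/-- With `P = Pˢ_p` and `Q = Pˢ_q`, the class is `[im P] + [im (1 - Q)] - [Θ(V)]`, and `[Θ(V)] = [im
(1 - Q)] + [im Q]`. -/
theorem indexClass_modelOp [ConnectedSpace B] (hp : Continuous p) (hq : Continuous q)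
    (hph : ∀ b, IsHyperbolic (p b)) (hqh : ∀ b, IsHyperbolic (q b))
    (hM : IsFredholmFamily fun b => modelOp (p b) (q b))
    (hV : IsTransversal (fun b => modelOp (p b) (q b)) (supportedIn d {-1}))
    (hP : IsProjectionFamily fun b => stableProjection (p b))
    (hQ : IsProjectionFamily fun b => stableProjection (q b)) :
    indexClass hM hV = (imageBundle hP).toKO - (imageBundle hQ).toKO := by
  have := hV.finite
  rw [indexClass, toKO_kernelBundle_modelOp hp hq hph hqh hM hV hP hQ.one_sub,
    ← toKO_image_one_sub_add hQ hQ.one_sub]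
  abel

end ModelFamily

/-! ### Comparison of an asymptotically hyperbolic field with its model. -/

section Field

open Filter

variable {Λ : Type*} [TopologicalSpace Λ] {d : ℕ}

/-- Equicontinuity provides one neighbourhood that serves all `n`, which the supremum norm turns
into an operator norm bound. -/
theorem LinearField.continuous_L (𝔸 : LinearField Λ d) : Continuous 𝔸.L := by
  refine continuous_of_eventually_norm_sub_le fun b ε hε => ?_
  filter_upwards [Metric.equicontinuousAt_iff_right.1 (𝔸.equicontinuous b) ε hε] with c hc
  refine norm_le_of_pointwise hε.le fun φ n => ?_
  have : (𝔸.L c - 𝔸.L b) φ n = (𝔸.A n b - 𝔸.A n c) (φ n) := by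
    change (φ (n + 1) - 𝔸.A n c (φ n)) - (φ (n + 1) - 𝔸.A n b (φ n)) = 𝔸.A n b (φ n) - 𝔸.A n c (φ n)
    abel
  rw [this]
  have h := hc n
  rw [dist_eq_norm] at h
  exact (𝔸.A n b - 𝔸.A n c).le_of_opNorm_le_of_le h.le (norm_apply_le φ n)

namespace IsAsymptoticallyHyperbolic

variable {𝔸 : LinearField Λ d} {p q : Λ → Op d}

theorem continuous_pos (h : IsAsymptoticallyHyperbolic 𝔸 p q) : Continuous p :=
  h.tendsto_pos.continuous (Frequently.of_forall 𝔸.equicontinuous.continuous)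

theorem continuous_neg (h : IsAsymptoticallyHyperbolic 𝔸 p q) : Continuous q :=
  h.tendsto_neg.continuous (Frequently.of_forall 𝔸.equicontinuous.continuous)

/-- Outside a finite set of indices, the operator of the field is as close as desired to the model
operator of its limits. -/
theorem exists_norm_cutoff_sub_le (h : IsAsymptoticallyHyperbolic 𝔸 p q) {ε : ℝ} (hε : 0 < ε) :
    ∃ s : Set ℤ, s.Finite ∧ -1 ∈ s ∧
      ∀ b, ‖cutoff sᶜ ∘L (modelOp (p b) (q b) - 𝔸.L b)‖ ≤ ε := by
  obtain ⟨m, hm⟩ := eventually_atTop.1 (Metric.tendstoUniformly_iff.1 h.tendsto_pos ε hε)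
  obtain ⟨k, hk⟩ := eventually_atBot.1 (Metric.tendstoUniformly_iff.1 h.tendsto_neg ε hε)
  -- Including `-1` in the interval ensures that indices to its left are negative and those to its
  -- right nonnegative, so each side meets the matching half of the model.
  refine ⟨Set.Icc (min k (-1)) (max m (-1)), Set.finite_Icc _ _, by simp, fun b => ?_⟩
  refine norm_le_of_pointwise hε.le fun φ n => ?_
  change ‖cutoff _ ((modelOp (p b) (q b) - 𝔸.L b) φ) n‖ ≤ _
  by_cases hn : n ∈ (Set.Icc (min k (-1)) (max m (-1)))ᶜ
  swap
  · rw [cutoff_of_notMem hn, norm_zero]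
    positivity
  rw [cutoff_of_mem hn]
  change ‖modelOp (p b) (q b) φ n - 𝔸.L b φ n‖ ≤ _
  rw [Set.mem_compl_iff, Set.mem_Icc, not_and_or, not_le, not_le] at hn
  rw [LinearField.L_apply]
  rcases hn with hn | hn
  · rw [lt_min_iff] at hn
    have h1 := hk n hn.1.le b
    rw [dist_eq_norm, norm_sub_rev] at h1
    rw [modelOp_of_neg _ _ _ (by omega), sub_sub_sub_cancel_left]
    exact (𝔸.A n b - q b).le_of_opNorm_le_of_le h1.le (norm_apply_le φ n)
  · rw [max_lt_iff] at hn
    have h1 := hm n hn.1.le b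
    rw [dist_eq_norm, norm_sub_rev] at h1
    rw [modelOp_of_nonneg _ _ _ (by omega), sub_sub_sub_cancel_left]
    exact (𝔸.A n b - p b).le_of_opNorm_le_of_le h1.le (norm_apply_le φ n)

/-- Up to a continuous family of invertible operators, the operators of the field agree with the
model operators of its limits modulo the sequences supported in some finite set. -/
theorem exists_units (h : IsAsymptoticallyHyperbolic 𝔸 p q) [CompactSpace Λ] :
    ∃ s : Set ℤ, s.Finite ∧ -1 ∈ s ∧ ∃ T : Λ → SeqZero d →L[ℝ] SeqZero d, Continuous T ∧
      (∀ b, IsUnit (T b)) ∧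
      ∀ b φ, 𝔸.L b φ - modelOp (p b) (q b) (T b φ) ∈ supportedIn d s := by
  have hp := h.continuous_pos
  have hq := h.continuous_neg
  have hR := continuous_modelInverse hp hq h.hyperbolic_pos h.hyperbolic_neg
  obtain ⟨C, hC0, hC⟩ := exists_norm_le hR
  -- With `C` a bound for the right inverses `R` of the model `M` and `K` the cutoff to the
  -- complement of `s`, this makes `‖R K (M - L)‖ ≤ 1/2`, so `T = 1 - R K (M - L)` is invertible.
  obtain ⟨s, hs, hs1, hsε⟩ := h.exists_norm_cutoff_sub_le (ε := (2 * C)⁻¹) (by positivity)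
  refine ⟨s, hs, hs1, fun b => 1 - modelInverse (p b) (q b) ∘L
    (cutoff sᶜ ∘L (modelOp (p b) (q b) - 𝔸.L b)),
    continuous_one_sub_comp hR (continuous_modelOp hp hq) 𝔸.continuous_L,
    fun b => isUnit_one_sub_comp hC0 (hC b) (hsε b), fun b φ => ?_⟩
  set y := cutoff sᶜ ((modelOp (p b) (q b) - 𝔸.L b) φ) with hy
  have h1 := supportedIn_mono (Set.singleton_subset_iff.2 hs1)
    (modelOp_modelInverse_sub_mem (h.hyperbolic_pos b) (h.hyperbolic_neg b) y)
  have h2 : y - (modelOp (p b) (q b) - 𝔸.L b) φ ∈ supportedIn d s := fun n hn => by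
    change y n - (modelOp (p b) (q b) - 𝔸.L b) φ n = 0
    rw [hy, cutoff_of_mem hn, sub_self]
  -- For `y = K (M - L) φ` one has `L φ - M T φ = (M R y - y) + (y - (M - L) φ)`; the first term is
  -- supported at `-1`, the second in `s`.
  have h3 := Submodule.add_mem _ h1 h2
  change 𝔸.L b φ - modelOp (p b) (q b) (φ - modelInverse (p b) (q b) y) ∈ supportedIn d s
  convert h3 using 1
  rw [map_sub (modelOp (p b) (q b))]
  change _ = _ + (y - (modelOp (p b) (q b) φ - 𝔸.L b φ))
  abel

end IsAsymptoticallyHyperbolic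

end Field

end

end FamilyIndex

/-! ### The index formula. -/

theorem mainTheorem6 {Λ : Type*} [MetricSpace Λ] [CompactSpace Λ] [PathConnectedSpace Λ] (d : ℕ)
    (𝔸 : LinearField Λ d) (aPos aNeg : Λ → Op d)
    (h : IsAsymptoticallyHyperbolic 𝔸 aPos aNeg) :
    ∃ (hL : IsFredholmFamily 𝔸.L)
      (hPos : IsProjectionFamily fun b => stableProjection (aPos b))
      (hNeg : IsProjectionFamily fun b => stableProjection (aNeg b)),
      indexBundle hL = (imageBundle hPos).toKO - (imageBundle hNeg).toKO ∧
      ∀ (V : Submodule ℝ (SeqZero d)) (hV : IsTransversal 𝔸.L V),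
        indexClass hL hV = (imageBundle hPos).toKO - (imageBundle hNeg).toKO := by
  have hp := h.continuous_pos
  have hq := h.continuous_neg
  have hph := h.hyperbolic_pos
  have hqh := h.hyperbolic_neg
  have hPos := isProjectionFamily_stableProjection hp hph
  have hNeg := isProjectionFamily_stableProjection hq hqh
  have hM := isFredholmFamily_modelOp hp hq hph hqh
  obtain ⟨s, hs, hs1, T, hT, hTu, hTs⟩ := h.exists_units
  have := finiteDimensional_supportedIn (d := d) hs
  have := finiteDimensional_supportedIn (d := d) (Set.finite_singleton (-1 : ℤ))
  have hR := fun b => modelOp_modelInverse_sub_mem (hph b) (hqh b)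
  have hle := supportedIn_mono (d := d) (Set.singleton_subset_iff.2 hs1)
  have hM1 : IsTransversal _ (supportedIn d {-1}) := isTransversal_of_rightInverse_mod _ _ hR
  have hMs : IsTransversal _ (supportedIn d s) := hM1.mono hle
  have hL : IsFredholmFamily 𝔸.L :=
    hM.of_sub_mem 𝔸.continuous_L hTu hTs fun b y => hle (hR b y)
  have hLs : IsTransversal 𝔸.L (supportedIn d s) := by
    refine isTransversal_of_rightInverse_mod
      (fun b => Ring.inverse (T b) ∘L modelInverse (aPos b) (aNeg b)) _ fun b y => ?_
    have h1 := hTs b (Ring.inverse (T b) (modelInverse (aPos b) (aNeg b) y))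
    rw [apply_inverse_apply (hTu b)] at h1
    simpa using Submodule.add_mem _ h1 (hle (hR b y))
  have key : ∀ (V : Submodule ℝ (SeqZero d)) (hV : IsTransversal 𝔸.L V),
      indexClass hL hV = (imageBundle hPos).toKO - (imageBundle hNeg).toKO := fun V hV => by
    -- For `L`, pass from `V` to the sequences supported in `s`; exchange `L` for the model; then
    -- shrink the support to `{-1}`, where the class is known.
    rw [indexClass_eq hL hV hLs, indexClass_eq_of_sub_mem hL hM hT hTu hTs hLs hMs,
      indexClass_eq hM hMs hM1, indexClass_modelOp hp hq hph hqh hM hM1 hPos hNeg]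
  exact ⟨hL, hPos, hNeg, key _ _, key⟩
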